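/- **Setting.** Let $\mathscr{P}$ be a finite set of processes and let $(\Sigma,\mathrm{loc})$ be a distributed alphabet over $\mathscr{P}$: a finite set $\Sigma=\bigcup_{i\in\mathscr P}\Sigma_i$ with all $\Sigma_i$ non-empty, and $\mathrm{loc}(a)=\{i\mid a\in\Sigma_i\}$. Letters $a,b$ are dependent if $\mathrm{loc}(a)\cap\mathrm{loc}(b)\neq\emptyset$. A trace is a finite $\Sigma$-labelled poset $t=(E,\le,\lambda)$ in which $e\lessdot f$ implies that $\lambda(e),\lambda(f)$ are dependent, and events with dependent labels are comparable; a trace language is a set of traces. Let $E_i=\{e\in E\mid i\in\mathrm{loc}(\lambda(e))\}$, let ${\Downarrow}e$ be the strict past of $e$, and let $e_i$ be the maximal event of ${\Downarrow}e\cap E_i$, if it exists. **Logic.** $\mathsf{LocTL}[\mathsf{Y}_{i\le j},\mathsf{S}_i]$ has event formulas $\alpha::=a\mid\neg\alpha\mid\alpha\vee\alpha\mid\mathsf{Y}_{i\le j}\mid\alpha\,\mathsf{S}_i\,\alpha$ and trace formulas $\beta::=\exists_i\alpha\mid\neg\beta\mid\beta\vee\beta$ ($a\in\Sigma$, $i,j\in\mathscr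 P$). Here $t,e\models a$ iff $\lambda(e)=a$; $t,e\models\mathsf{Y}_{i\le j}$ iff $e_i,e_j$ exist and $e_i\le e_j$; $t,e\models\alpha\,\mathsf{S}_i\,\alpha'$ iff $e\in E_i$ and there is $f\in E_i$ with $f<e$, $t,f\models\alpha'$, and $t,g\models\alpha$ for all $g\in E_i$ with $f<g<e$; $t\models\exists_i\alpha$ iff there is a maximal event $e$ of $E_i$ with $t,e\models\alpha$; Boolean connectives are as usual. A language $L$ is definable if $L=\{t\mid t\models\beta\}$ for some trace formula $\beta$. **Automata.** An asynchronous automaton over $(\Sigma,\mathrm{loc})$ consists of finite non-empty local state sets $S_i$ ($i\in\mathscr P$), maps $\delta_a\colon S_a\to S_a$ with $S_a=\prod_{i\in\mathrm{loc}(a)}S_i$ ($a\in\Sigma$), and an initial global state in $\prod_{i\in\mathscr P}S_i$. Each letter $a$ updates the $\mathrm{loc}(a)$-components by $\delta_a$; $A(t)$ is the global state reached on any linearization of $t$. The automaton has the form $U_2[p]$ if $S_p$ has two elements, $S_i$ is a singleton for $i\ne p$, and there are disjoint $R_1,R_2\subseteq\Sigma_p$ whose letters reset the state of $p$ to the first,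 resp. second, element, while all other letters act as the identity. The local cascade product of $A_1=(\{S_i\},\{\delta_a\},s)$ and an automaton $A_2=(\{Q_i\},\{\delta_{(a,s_a)}\},q)$ over the distributed alphabet of pairs $(a,s_a)$ ($a\in\Sigma$, $s_a\in S_a$, $\mathrm{loc}(a,s_a)=\mathrm{loc}(a)$) has local states $S_i\times Q_i$, initial state $(s,q)$ and transitions $(s_a,q_a)\mapsto(\delta_a(s_a),\delta_{(a,s_a)}(q_a))$. Let $\Gamma=\{0,1\}^{\mathscr P\times\mathscr P}$, and let $\theta^{\mathsf Y}$ be the labelling which adds to each event $e$ of each trace the element of $\Gamma$ whose $(i,j)$-entry is the truth value of $\mathsf{Y}_{i\le j}$ at $e$. A gossip automaton is an asynchronous automaton $\mathcal G=(\{\Upsilon_i\},\{\nabla_a\},v)$ together with maps $\mu_a\colon\Upsilon_a\to\Gamma$ which computes $\theta^{\mathsf Y}$, i.e. for every event $e$ of every trace, with $a=\lambda(e)$, the label added to $e$ by $\theta^{\mathsf Y}$ is $\mu_a$ applied to the restriction of $\mathcal G({\Downarrow}e)$ to $\mathrm{loc}(a)$. For an asynchronous automaton $A=(\{S_i\},\{\delta_{(a,\gamma)}\},s)$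 over $\Sigma\times\Gamma$ (with $\mathrm{loc}(a,\gamma)=\mathrm{loc}(a)$), the $\theta^{\mathsf Y}$-restricted local cascade product $\mathcal G\circ_\ell^{r}A$ has local states $\Upsilon_i\times S_i$, initial state $(v,s)$ and transitions $(\upsilon_a,s_a)\mapsto(\nabla_a(\upsilon_a),\delta_{(a,\mu_a(\upsilon_a))}(s_a))$. A language $L$ is accepted by it if, for some set $F$ of global states of $A$, $L$ is the set of traces $t$ such that the $A$-component of $(\mathcal G\circ_\ell^{r}A)(t)$ is in $F$ (all global states of $\mathcal G$ are accepting). **Statement.** A gossip automaton over $(\Sigma,\mathrm{loc})$ exists. For every gossip automaton $\mathcal G$ over $(\Sigma,\mathrm{loc})$ and every trace language $L$ over $(\Sigma,\mathrm{loc})$: $L$ is definable in $\mathsf{LocTL}[\mathsf{Y}_{i\le j},\mathsf{S}_i]$ if and only if there is a local cascade product $A=A_1\circ_\ell\cdots\circ_\ell A_n$ ($n\ge1$) of automata of the form $U_2[p]$ ($p\in\mathscr P$ may vary with the factor), with $A$ over $\Sigma\times\Gamma$, such that $L$ is accepted by $\mathcal G\circ_\ell^{r}A$. -/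

import Mathlib

/-- A distributed alphabet over the set `P` of processes, with letter set `Letter`, given by its
location function. `Σ_i` is `{a | i ∈ loc a}`; the letter set is the union of the `Σ_i`, and each
`Σ_i` is non-empty. (`P` and `Letter` are assumed finite in the theorem.) -/
structure DistAlphabet (P : Type*) (Letter : Type*) where
  loc : Letter → Set P
  loc_nonempty : ∀ a, (loc a).Nonempty
  proc_nonempty : ∀ i, ∃ a, i ∈ loc a

namespace DistAlphabet

variable {P Letter : Type*}

/-- The dependence relation: the two letters share a process. -/
def Dep (D : DistAlphabet P Letter) (a b : Letter) : Prop := (D.loc a ∩ D.loc b).Nonempty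

/-- The distributed alphabet on `Σ × Γ`, with `loc (a, γ) = loc a`. -/
def prodLabel (D : DistAlphabet P Letter) (Γ : Type*) [Nonempty Γ] :
    DistAlphabet P (Letter × Γ) where
  loc x := D.loc x.1
  loc_nonempty x := D.loc_nonempty x.1
  proc_nonempty i := by
    obtain ⟨a, ha⟩ := D.proc_nonempty i
    exact ⟨(a, Classical.arbitrary Γ), ha⟩

/-- `S_a`: the `a`-states, for a family `S` of local state sets. -/
abbrev LState (D : DistAlphabet P Letter) (S : P → Type) (a : Letter) : Type _ :=
  ∀ i : D.loc a, S i.1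

/-- The distributed alphabet of pairs `(a, s_a)`, `s_a ∈ S_a`, with `loc (a, s_a) = loc a`. -/
def prodLocal (D : DistAlphabet P Letter) (S : P → Type) (hS : ∀ i, Nonempty (S i)) :
    DistAlphabet P (Σ a : Letter, D.LState S a) where
  loc x := D.loc x.1
  loc_nonempty x := D.loc_nonempty x.1
  proc_nonempty i := by
    obtain ⟨a, ha⟩ := D.proc_nonempty i
    exact ⟨⟨a, fun j => Classical.choice (hS j.1)⟩, ha⟩

end DistAlphabet

/-- A (Mazurkiewicz) trace over `D`: a finite labelled poset of events. -/
structure MTrace {P Letter : Type*} (D : DistAlphabet P Letter) where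
  E : Type
  finite : Finite E
  order : PartialOrder E
  label : E → Letter
  dep_of_covBy : ∀ e f : E, e ⋖ f → D.Dep (label e) (label f)
  comparable : ∀ e f : E, D.Dep (label e) (label f) → e ≤ f ∨ f ≤ e

namespace MTrace

variable {P Letter : Type*} {D : DistAlphabet P Letter}

instance (t : MTrace D) : Finite t.E := t.finite
instance (t : MTrace D) : PartialOrder t.E := t.order

/-- `E_i`: the events in which process `i` participates. -/
def procEvents (t : MTrace D) (i : P) : Set t.E := {e | i ∈ D.loc (t.label e)}

/-- The prefix of `t` induced by a downward closed set of events. -/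
def restrict (t : MTrace D) (C : Set t.E) (hC : IsLowerSet C) : MTrace D where
  E := C
  finite := inferInstance
  order := inferInstance
  label e := t.label e.1
  dep_of_covBy e f h := by
    refine t.dep_of_covBy e.1 f.1 ⟨h.1, fun g h1 h2 => ?_⟩
    exact h.2 (c := ⟨g, hC h2.le f.2⟩) h1 h2
  comparable e f h := t.comparable e.1 f.1 h

/-- The prefix of `t` given by the strict past of the event `e`. -/
def strictPast (t : MTrace D) (e : t.E) : MTrace D :=
  t.restrict (Set.Iio e) (isLowerSet_Iio e)

/-- `l` enumerates all events of `t`, each once, in an order compatible with that of `t`. -/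
def IsLinearization (t : MTrace D) (l : List t.E) : Prop :=
  l.Nodup ∧ (∀ e, e ∈ l) ∧ l.Pairwise (fun e f => ¬ f < e)

theorem exists_linearization (t : MTrace D) : ∃ l, t.IsLinearization l := by
  classical
  have : Fintype t.E := Fintype.ofFinite _
  have : Fintype (LinearExtension t.E) := inferInstanceAs (Fintype t.E)
  let l : List (LinearExtension t.E) := Finset.sort (Finset.univ : Finset (LinearExtension t.E))
  have h1 : l.Nodup := Finset.sort_nodup _ _
  have h2 : ∀ e, e ∈ l := fun e => (Finset.mem_sort _).2 (Finset.mem_univ e)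
  have h3 : l.Pairwise (fun e f => e ≤ f) := Finset.pairwise_sort _ _
  refine ⟨(l : List t.E), h1, h2, ?_⟩
  have h4 : l.Pairwise (fun e f => e ≤ f ∧ e ≠ f) := h3.and h1
  refine List.Pairwise.imp (R := fun e f : LinearExtension t.E => e ≤ f ∧ e ≠ f) ?_ h4
  rintro e f ⟨hef, hne⟩ hlt
  have hfe : toLinearExtension (α := t.E) f ≤ toLinearExtension (α := t.E) e :=
    toLinearExtension.monotone (le_of_lt hlt)
  exact hne (le_antisymm hef hfe)

/-- `e_i`, as a relation: `f` is the maximal event of process `i` in the strict past of `e`. -/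
def IsLast (t : MTrace D) (e : t.E) (i : P) (f : t.E) : Prop :=
  Maximal (fun g => g ∈ Set.Iio e ∩ t.procEvents i) f

/-- The truth value of the constant `Y_{i ≤ j}` at `e`: the events `e_i` and `e_j` exist, and
`e_i ≤ e_j`. -/
def YLe (t : MTrace D) (e : t.E) (i j : P) : Prop :=
  ∃ f g, t.IsLast e i f ∧ t.IsLast e j g ∧ f ≤ g

end MTrace

/-- Event formulas of `LocTL[Y_{i ≤ j}, S_i]`. -/
inductive EventFormula (P Letter : Type*) where
  | letter (a : Letter)
  | neg (φ : EventFormula P Letter)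
  | or (φ ψ : EventFormula P Letter)
  | yle (i j : P)
  | since (i : P) (φ ψ : EventFormula P Letter)

/-- Trace formulas of `LocTL[Y_{i ≤ j}, S_i]`. -/
inductive TraceFormula (P Letter : Type*) where
  | ex (i : P) (φ : EventFormula P Letter)
  | neg (β : TraceFormula P Letter)
  | or (β β' : TraceFormula P Letter)

section Semantics

variable {P Letter : Type*} {D : DistAlphabet P Letter}

/-- `t, e ⊨ φ`; the since operators are strict. -/
def EventFormula.Sat (t : MTrace D) : EventFormula P Letter → t.E → Prop
  | .letter a, e => t.label e = a
  | .neg φ, e => ¬ φ.Sat t e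
  | .or φ ψ, e => φ.Sat t e ∨ ψ.Sat t e
  | .yle i j, e => t.YLe e i j
  | .since i φ ψ, e => e ∈ t.procEvents i ∧ ∃ f ∈ t.procEvents i, f < e ∧ ψ.Sat t f ∧
      ∀ g ∈ t.procEvents i, f < g → g < e → φ.Sat t g

/-- `t ⊨ β`. -/
def TraceFormula.Sat (t : MTrace D) : TraceFormula P Letter → Prop
  | .ex i φ => ∃ e, Maximal (fun g => g ∈ t.procEvents i) e ∧ φ.Sat t e
  | .neg β => ¬ β.Sat t
  | .or β β' => β.Sat t ∨ β'.Sat t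

/-- `L` is definable in `LocTL[Y_{i ≤ j}, S_i]`. -/
def LocTLDefinable (L : Set (MTrace D)) : Prop :=
  ∃ β : TraceFormula P Letter, L = {t | β.Sat t}

end Semantics

/-- An asynchronous automaton over `D` (without acceptance condition). -/
structure AsyncAutomaton {P Letter : Type*} (D : DistAlphabet P Letter) where
  S : P → Type
  finite : ∀ i, Finite (S i)
  δ : ∀ a, D.LState S a → D.LState S a
  init : ∀ i, S i

namespace AsyncAutomaton

variable {P Letter : Type*} {D : DistAlphabet P Letter}

/-- Global states. -/
abbrev Global (A : AsyncAutomaton D) : Type _ := ∀ i, A.S i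

/-- `s_a`: the restriction of a global state to the processes of `a`. -/
def proj (A : AsyncAutomaton D) (a : Letter) (s : A.Global) : D.LState A.S a := fun i => s i.1

open Classical in
/-- `Δ_a`: the extension of `δ_a` to global states. -/
noncomputable def step (A : AsyncAutomaton D) (s : A.Global) (a : Letter) : A.Global :=
  fun i => if h : i ∈ D.loc a then A.δ a (A.proj a s) ⟨i, h⟩ else s i

/-- The global state reached from `s` on a word. -/
noncomputable def runWord (A : AsyncAutomaton D) (s : A.Global) (w : List Letter) : A.Global :=
  w.foldl A.step s

/-- `A(t)`: the global state reached when running `A` on the trace `t`, computed along a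
linearization of `t` (all linearizations give the same state, see `run_eq`). -/
noncomputable def run (A : AsyncAutomaton D) (t : MTrace D) : A.Global :=
  A.runWord A.init (t.exists_linearization.choose.map t.label)

theorem step_comm (A : AsyncAutomaton D) (s : A.Global) {a b : Letter} (h : ¬ D.Dep a b) :
    A.step (A.step s a) b = A.step (A.step s b) a := by
  have key : ∀ i, i ∈ D.loc a → i ∉ D.loc b := fun i ha hb => h ⟨i, ha, hb⟩
  have pa : A.proj a (A.step s b) = A.proj a s := by
    funext i
    simp [proj, step, key i.1 i.2]
  have pb : A.proj b (A.step s a) = A.proj b s := by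
    funext i
    have : i.1 ∉ D.loc a := fun ha => key i.1 ha i.2
    simp [proj, step, this]
  funext i
  by_cases ha : i ∈ D.loc a
  · have hb := key i ha
    rw [step, dif_neg hb, step, dif_pos ha, step, dif_pos ha, pa]
  · by_cases hb : i ∈ D.loc b
    · rw [step, dif_pos hb, pb, step, dif_neg ha, step, dif_pos hb]
    · simp only [step, dif_neg ha, dif_neg hb]

theorem runWord_move (A : AsyncAutomaton D) (t : MTrace D) (e : t.E) (x : List t.E)
    (h : ∀ f ∈ x, ¬ D.Dep (t.label e) (t.label f)) (s : A.Global) :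
    A.runWord (A.step s (t.label e)) (x.map t.label) =
      A.step (A.runWord s (x.map t.label)) (t.label e) := by
  induction x generalizing s with
  | nil => rfl
  | cons f x ih =>
    have h1 := ih (fun g hg => h g (List.mem_cons_of_mem _ hg)) (A.step s (t.label f))
    simp only [runWord, List.map_cons, List.foldl_cons] at h1 ⊢
    rw [A.step_comm s (h f List.mem_cons_self), h1]

theorem runWord_perm (A : AsyncAutomaton D) (t : MTrace D) (l l' : List t.E) (hp : l.Perm l')
    (hn : l.Nodup) (h : l.Pairwise (fun e f => ¬ f < e)) (h' : l'.Pairwise (fun e f => ¬ f < e))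
    (s : A.Global) : A.runWord s (l.map t.label) = A.runWord s (l'.map t.label) := by
  induction l generalizing l' s with
  | nil => rw [hp.nil_eq]
  | cons e l ih =>
    obtain ⟨x, y, rfl⟩ := List.append_of_mem (hp.subset List.mem_cons_self)
    have hp' : l.Perm (x ++ y) := (hp.trans List.perm_middle).cons_inv
    rw [List.pairwise_cons] at h
    rw [List.nodup_cons] at hn
    have hxe : ∀ f ∈ x, ¬ D.Dep (t.label e) (t.label f) := by
      intro f hf hd
      have hfl : f ∈ l := hp'.symm.subset (List.mem_append_left _ hf)
      have h1 : ¬ f < e := h.1 f hfl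
      have h2 : ¬ e < f := (List.pairwise_append.1 h').2.2 f hf e List.mem_cons_self
      have hne : e ≠ f := fun he => hn.1 (he ▸ hfl)
      rcases t.comparable e f hd with h3 | h3
      · exact h2 (lt_of_le_of_ne h3 hne)
      · exact h1 (lt_of_le_of_ne h3 hne.symm)
    have h'' : (x ++ y).Pairwise (fun e f => ¬ f < e) := by
      refine h'.sublist ?_
      exact List.Sublist.append (List.Sublist.refl x) (List.sublist_cons_self e y)
    have hm := A.runWord_move t e x hxe s
    have := ih (x ++ y) hp' hn.2 h.2 h'' (A.step s (t.label e))
    simp only [runWord, List.map_cons, List.foldl_cons, List.map_append, List.foldl_append]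
      at this hm ⊢
    rw [this, hm]

/-- The state reached on a trace does not depend on the linearization. -/
theorem run_eq (A : AsyncAutomaton D) (t : MTrace D) (l : List t.E) (hl : t.IsLinearization l) :
    A.run t = A.runWord A.init (l.map t.label) := by
  have hc := t.exists_linearization.choose_spec
  refine A.runWord_perm t _ l ?_ hc.1 hc.2.2 hl.2.2 A.init
  exact (List.perm_ext_iff_of_nodup hc.1 hl.1).2 fun e => by simp [hc.2.1 e, hl.2.1 e]

/-- `L` is accepted by `A` with the set `F` of final global states. -/
def AcceptsWith (A : AsyncAutomaton D) (F : Set A.Global) (L : Set (MTrace D)) : Prop :=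
  L = {t | A.run t ∈ F}

/-- The letters `(a, s_a)` read by the second factor of a local cascade product with first
factor `A`. -/
abbrev outAlphabet (A : AsyncAutomaton D) : DistAlphabet P (Σ a : Letter, D.LState A.S a) :=
  D.prodLocal A.S fun i => ⟨A.init i⟩

/-- The local cascade product of `A` and `B`. -/
def localCascade (A : AsyncAutomaton D) (B : AsyncAutomaton A.outAlphabet) :
    AsyncAutomaton D where
  S i := A.S i × B.S i
  finite i := by
    have := A.finite i
    have := B.finite i
    infer_instance
  δ a r := fun i =>
    (A.δ a (fun j => (r j).1) i, B.δ ⟨a, fun j => (r j).1⟩ (fun j => (r j).2) i)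
  init i := (A.init i, B.init i)

open Classical in
/-- The reset automaton `U_2[p]`. The local state set `i = p → Bool` has two elements for `i = p`
and one element for `i ≠ p`; the letters in `R₁` and in `R₂` reset the state of `p` to the first
and to the second of its two states, and all other letters act as the identity. -/
noncomputable def U2 (D : DistAlphabet P Letter) (p : P) (R₁ R₂ : Set Letter) (c : Bool) :
    AsyncAutomaton D where
  S i := i = p → Bool
  finite _ := inferInstance
  δ a q := fun i h => if a ∈ R₁ then false else if a ∈ R₂ then true else q i h
  init _ _ := c

/-- Local cascade products `A_1 ∘ ⋯ ∘ A_n` (`n ≥ 1`) of automata of the form `U_2[p]`, where the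
process `p`, the reset sets `R₁`, `R₂` (disjoint sets of letters in which `p` participates) and the
initial state may be different for each factor. -/
inductive IsU2Cascade {P Letter : Type*} {D : DistAlphabet P Letter} : AsyncAutomaton D → Prop
  | single (p : P) (R₁ R₂ : Set Letter) (c : Bool)
      (h₁ : ∀ a ∈ R₁, p ∈ D.loc a) (h₂ : ∀ a ∈ R₂, p ∈ D.loc a) (hd : Disjoint R₁ R₂) :
      IsU2Cascade (U2 D p R₁ R₂ c)
  | cascade (A : AsyncAutomaton D) (hA : IsU2Cascade A)
      (p : P) (R₁ R₂ : Set (Σ a : Letter, D.LState A.S a)) (c : Bool)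
      (h₁ : ∀ x ∈ R₁, p ∈ A.outAlphabet.loc x) (h₂ : ∀ x ∈ R₂, p ∈ A.outAlphabet.loc x)
      (hd : Disjoint R₁ R₂) :
      IsU2Cascade (A.localCascade (U2 A.outAlphabet p R₁ R₂ c))

end AsyncAutomaton

/-- An asynchronous `Γ`-transducer: an asynchronous automaton with output functions `μ_a`. -/
structure AsyncTransducer {P Letter : Type*} (D : DistAlphabet P Letter) (Γ : Type*) where
  toAut : AsyncAutomaton D
  μ : ∀ a, D.LState toAut.S a → Γ

namespace AsyncTransducer

variable {P Letter : Type*} {D : DistAlphabet P Letter} {Γ : Type*}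

/-- The label that the transducer adds to the event `e` of `t`: it depends on the `a`-state
reached on the strict past of `e`, where `a` is the letter of `e`. -/
noncomputable def output (G : AsyncTransducer D Γ) (t : MTrace D) (e : t.E) : Γ :=
  G.μ (t.label e) (G.toAut.proj (t.label e) (G.toAut.run (t.strictPast e)))

/-- `G` computes the `Γ`-labelling function which adds the label `θ t e` to each event `e` of each
trace `t`. -/
def Computes (G : AsyncTransducer D Γ) (θ : ∀ t : MTrace D, t.E → Γ) : Prop :=
  ∀ t e, G.output t e = θ t e

/-- The restricted local cascade product: run `G` on the input trace, and `A` on the trace whose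
labels are enriched with the outputs of `G`. -/
def restrictedCascade [Nonempty Γ] (G : AsyncTransducer D Γ) (A : AsyncAutomaton (D.prodLabel Γ)) :
    AsyncAutomaton D where
  S i := G.toAut.S i × A.S i
  finite i := by
    have := G.toAut.finite i
    have := A.finite i
    infer_instance
  δ a r := fun i =>
    (G.toAut.δ a (fun j => (r j).1) i,
      A.δ (a, G.μ a (fun j => (r j).1)) (fun j => (r j).2) i)
  init i := (G.toAut.init i, A.init i)

end AsyncTransducer

open Classical in
/-- The primary order labelling function `θ^Y`: it decorates each event with the truth values of
all the constants `Y_{i ≤ j}`. -/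
noncomputable def primaryOrder {P Letter : Type*} (D : DistAlphabet P Letter) (t : MTrace D)
    (e : t.E) : P → P → Bool :=
  fun i j => decide (t.YLe e i j)

/-- A gossip automaton over `D`: an asynchronous automaton, with its output functions, which
computes the primary order labelling function. -/
def IsGossip {P Letter : Type*} {D : DistAlphabet P Letter}
    (G : AsyncTransducer D (P → P → Bool)) : Prop :=
  G.Computes (primaryOrder D)

/-- `L` is accepted by the restricted local cascade product of `G` with some local cascade product
`A` of automata of the form `U_2[p]`. All global states of `G` count as accepting: the acceptance
condition is a set `F` of global states of `A`. -/
def AcceptedByRestrictedU2Cascade {P Letter : Type*} {D : DistAlphabet P Letter}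
    (G : AsyncTransducer D (P → P → Bool)) (L : Set (MTrace D)) : Prop :=
  ∃ A : AsyncAutomaton (D.prodLabel (P → P → Bool)), AsyncAutomaton.IsU2Cascade A ∧
    ∃ F : Set A.Global,
      (G.restrictedCascade A).AcceptsWith {r | (fun i => (r i).2) ∈ F} L

/-! Existence of a gossip automaton. Each process stores bounded time stamps for its latest
information, three levels deep: the last `s`-event below the last `r`-event below the last `q`-event
in its past. The decisive order fact is `le_or_exists_isLastIn`: a maximal common predecessor of `v`
and `f` is the last event of some process below `v`, unless `f ≤ v`. Thus whatever two pasts share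
lies below events that the tables mention. This has two consequences. A stamp reused by a later
event can never be confused with one still in the first two levels (`eq_of_stamp_eq`), because the
third level shows which stamps are in use. And the processes meeting at an event can tell, by
equality of stamps alone, which of them knows most about `q` (`lastBelow_best`). Then `e_i ≤ e_j`
holds iff `e_i` exists and is the last `i`-event below `e_j`, again an equality of stamps.

Equivalence. A gossip automaton, whichever it is, feeds `A` exactly the truth values of the `Y_{i ≤
j}`, so only the cascade of resets has to be matched with the since operators. As a function of the
prefix, the state of a factor `U_2[p]` is a bit that depends on the most recent resetting `p`-event
(`IsResetBit`).

From formulas to automata: a bit set to true at `ψ`, set to false where neither `ψ` nor `φ` holds,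
and otherwise kept, computes `φ S_p ψ`. Induction on the formula appends one such factor per since
operator, and one for each `∃_p φ`, which is "false since `φ`" seen from the end of the trace.

From automata to formulas: the bit is a Boolean combination of since formulas over the two reset
conditions (`IsResetBit.eq_true_iff`). In a cascade these conditions speak of the letter, the
primary order and the states of the earlier factors, so induction on the number of factors gives
formulas for all local states. -/

namespace MTrace

/-! ### Last events of a process in a set of events. -/

variable {P Letter : Type*} {D : DistAlphabet P Letter}

/-- `f` is the last event of process `i` in the set `C` of events. -/
def IsLastIn (t : MTrace D) (C : Set t.E) (i : P) (f : t.E) : Prop :=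
  f ∈ C ∧ f ∈ t.procEvents i ∧ ∀ g ∈ C, g ∈ t.procEvents i → g ≤ f

theorem procEvents_total (t : MTrace D) {i : P} {e f : t.E} (he : e ∈ t.procEvents i)
    (hf : f ∈ t.procEvents i) : e ≤ f ∨ f ≤ e :=
  t.comparable e f ⟨i, he, hf⟩

theorem isLastIn_iff_maximal (t : MTrace D) (C : Set t.E) (i : P) (f : t.E) :
    t.IsLastIn C i f ↔ Maximal (fun g => g ∈ C ∩ t.procEvents i) f := by
  constructor
  · rintro ⟨h1, h2, h3⟩
    exact ⟨⟨h1, h2⟩, fun g hg _ => h3 g hg.1 hg.2⟩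
  · rintro ⟨⟨h1, h2⟩, h3⟩
    refine ⟨h1, h2, fun g hg hgi => ?_⟩
    rcases t.procEvents_total hgi h2 with h | h
    · exact h
    · exact h3 ⟨hg, hgi⟩ h

theorem isLast_iff (t : MTrace D) (e : t.E) (i : P) (f : t.E) :
    t.IsLast e i f ↔ t.IsLastIn (Set.Iio e) i f :=
  (t.isLastIn_iff_maximal _ _ _).symm

theorem IsLastIn.unique {t : MTrace D} {C : Set t.E} {i : P} {f g : t.E}
    (hf : t.IsLastIn C i f) (hg : t.IsLastIn C i g) : f = g :=
  le_antisymm (hg.2.2 f hf.1 hf.2.1) (hf.2.2 g hg.1 hg.2.1)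

theorem exists_isLastIn (t : MTrace D) {C : Set t.E} {i : P} {e : t.E} (he : e ∈ C)
    (hi : e ∈ t.procEvents i) : ∃ f, t.IsLastIn C i f := by
  obtain ⟨f, -, hf⟩ := (Set.toFinite (C ∩ t.procEvents i)).exists_le_maximal ⟨he, hi⟩
  exact ⟨f, (t.isLastIn_iff_maximal _ _ _).2 hf⟩

theorem no_event_or_isLastIn (t : MTrace D) (C : Set t.E) (i : P) :
    (∀ e ∈ C, e ∉ t.procEvents i) ∨ ∃ f, t.IsLastIn C i f := by
  by_cases h : ∃ e ∈ C, e ∈ t.procEvents i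
  · obtain ⟨e, he, hi⟩ := h
    exact Or.inr (t.exists_isLastIn he hi)
  · exact Or.inl fun e he hi => h ⟨e, he, hi⟩

/-- Induction over the prefixes of a trace along the events of the process `i`. -/
theorem prefix_induction (t : MTrace D) (i : P) {Q : ∀ C : Set t.E, IsLowerSet C → Prop}
    (zero : ∀ C hC, (∀ e ∈ C, e ∉ t.procEvents i) → Q C hC)
    (succ : ∀ C hC f, t.IsLastIn C i f → Q (Set.Iio f) (isLowerSet_Iio f) → Q C hC)
    (C : Set t.E) (hC : IsLowerSet C) : Q C hC := by
  have key : ∀ f : t.E, Q (Set.Iio f) (isLowerSet_Iio f) := by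
    intro f
    induction f using (Finite.wellFounded_of_trans_of_irrefl (fun a b : t.E => a < b)).induction with
    | _ f ih =>
      rcases t.no_event_or_isLastIn (Set.Iio f) i with h | ⟨g, hg⟩
      · exact zero _ _ h
      · exact succ _ _ g hg (ih g hg.1)
  rcases t.no_event_or_isLastIn C i with h | ⟨g, hg⟩
  · exact zero _ _ h
  · exact succ _ _ g hg (key g)

theorem lt_induction (t : MTrace D) {Q : t.E → Prop} (h : ∀ e, (∀ f, f < e → Q f) → Q e)
    (e : t.E) : Q e :=
  (Finite.wellFounded_of_trans_of_irrefl (fun a b : t.E => a < b)).induction e h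

end MTrace

/-! ### Runs of asynchronous automata on prefixes. -/

namespace AsyncAutomaton

open MTrace

variable {P Letter : Type*} {D : DistAlphabet P Letter}

theorem run_restrict (A : AsyncAutomaton D) (t : MTrace D) (C : Set t.E) (hC : IsLowerSet C)
    (l : List t.E) (hn : l.Nodup) (hl : ∀ e, e ∈ l ↔ e ∈ C)
    (hp : l.Pairwise (fun e f => ¬ f < e)) :
    A.run (t.restrict C hC) = A.runWord A.init (l.map t.label) := by
  have hm : ∀ e ∈ l, e ∈ C := fun e he => (hl e).1 he
  rw [A.run_eq (t.restrict C hC) (l.attachWith (· ∈ C) hm)]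
  · congr 1
    have : (l.attachWith (· ∈ C) hm).map Subtype.val = l := by simp
    conv_rhs => rw [← this, List.map_map]
    rfl
  · refine ⟨?_, ?_, ?_⟩
    · have : ((l.attachWith (· ∈ C) hm).map Subtype.val).Nodup := by simpa using hn
      exact List.Nodup.of_map _ this
    · rintro ⟨e, he⟩
      exact (List.mem_attachWith hm ⟨e, he⟩).2 ((hl e).2 he)
    · have : ((l.attachWith (· ∈ C) hm).map Subtype.val).Pairwise (fun e f => ¬ f < e) := by
        simpa using hp
      exact List.pairwise_map.1 this

theorem run_eq_run_restrict_univ (A : AsyncAutomaton D) (t : MTrace D) :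
    A.run t = A.run (t.restrict Set.univ isLowerSet_univ) := by
  obtain ⟨l, hl⟩ := t.exists_linearization
  rw [A.run_eq t l hl, A.run_restrict t _ _ l hl.1 (fun e => by simp [hl.2.1 e]) hl.2.2]

theorem step_of_notMem (A : AsyncAutomaton D) (s : A.Global) {a : Letter} {i : P}
    (h : i ∉ D.loc a) : A.step s a i = s i := by
  simp [step, h]

theorem runWord_of_notMem (A : AsyncAutomaton D) (w : List Letter) {i : P}
    (h : ∀ a ∈ w, i ∉ D.loc a) (s : A.Global) : A.runWord s w i = s i := by
  induction w generalizing s with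
  | nil => rfl
  | cons a w ih =>
    have := ih (fun b hb => h b (List.mem_cons_of_mem _ hb)) (A.step s a)
    rw [A.step_of_notMem s (h a List.mem_cons_self)] at this
    exact this

/-- `C'` can be linearized with `C` first, and the remaining events do not touch the state of `i`.
-/
theorem run_restrict_congr (A : AsyncAutomaton D) (t : MTrace D) {C C' : Set t.E}
    (hC : IsLowerSet C) (hC' : IsLowerSet C') (hsub : C ⊆ C') {i : P}
    (h : ∀ e ∈ C', e ∉ C → e ∉ t.procEvents i) :
    A.run (t.restrict C' hC') i = A.run (t.restrict C hC) i := by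
  classical
  obtain ⟨l, hl⟩ := t.exists_linearization
  rw [A.run_restrict t C' hC' (l.filter (· ∈ C) ++ l.filter (fun e => e ∈ C' ∧ e ∉ C)),
    A.run_restrict t C hC (l.filter (· ∈ C)) (hl.1.filter _) _ (hl.2.2.filter _)]
  · rw [List.map_append, runWord, List.foldl_append]
    refine A.runWord_of_notMem _ ?_ _
    intro a ha
    obtain ⟨e, he, rfl⟩ := List.mem_map.1 ha
    have he := (List.mem_filter.1 he).2
    simp only [decide_eq_true_eq] at he
    exact h e he.1 he.2
  · intro e
    simp [hl.2.1 e]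
  · refine List.nodup_append'.2 ⟨hl.1.filter _, hl.1.filter _, ?_⟩
    intro e h1 h2
    simp only [List.mem_filter, decide_eq_true_eq] at h1 h2
    exact h2.2.2 h1.2
  · intro e
    simp only [List.mem_append, List.mem_filter, hl.2.1 e, decide_eq_true_eq, true_and]
    constructor
    · rintro (h | h)
      · exact hsub h
      · exact h.1
    · intro h
      by_cases he : e ∈ C
      · exact Or.inl he
      · exact Or.inr ⟨h, he⟩
  · refine List.pairwise_append.2 ⟨hl.2.2.filter _, hl.2.2.filter _, ?_⟩
    intro e h1 f h2 hlt
    simp only [List.mem_filter, decide_eq_true_eq] at h1 h2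
    exact h2.2.2 (hC hlt.le h1.2)

theorem run_restrict_Iic (A : AsyncAutomaton D) (t : MTrace D) (f : t.E) :
    A.run (t.restrict (Set.Iic f) (isLowerSet_Iic f)) =
      A.step (A.run (t.strictPast f)) (t.label f) := by
  classical
  obtain ⟨l, hl⟩ := t.exists_linearization
  rw [strictPast, A.run_restrict t (Set.Iio f) _ (l.filter (· ∈ Set.Iio f)) (hl.1.filter _)
      (by simp [hl.2.1]) (hl.2.2.filter _),
    A.run_restrict t (Set.Iic f) _ (l.filter (· ∈ Set.Iio f) ++ [f])]
  · simp [runWord]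
  · refine List.nodup_append'.2 ⟨hl.1.filter _, List.nodup_singleton f, ?_⟩
    intro e h1 h2
    simp only [List.mem_filter, decide_eq_true_eq, List.mem_singleton, Set.mem_Iio] at h1 h2
    exact h1.2.ne h2
  · intro e
    simp [hl.2.1 e, le_iff_lt_or_eq]
  · refine List.pairwise_append.2 ⟨hl.2.2.filter _, List.pairwise_singleton _ _, ?_⟩
    intro e h1 g h2 hlt
    simp only [List.mem_filter, decide_eq_true_eq, List.mem_singleton, Set.mem_Iio] at h1 h2
    subst h2
    exact lt_asymm hlt h1.2

/-- The local state of a process without events. -/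
theorem run_restrict_of_no_event (A : AsyncAutomaton D) (t : MTrace D) {C : Set t.E}
    (hC : IsLowerSet C) {i : P} (h : ∀ e ∈ C, e ∉ t.procEvents i) :
    A.run (t.restrict C hC) i = A.init i := by
  rw [A.run_restrict_congr t isLowerSet_empty hC (Set.empty_subset C) (fun e he _ => h e he),
    A.run_restrict t ∅ _ [] List.nodup_nil (by simp) List.Pairwise.nil]
  rfl

/-- The local state of a process is determined at its last event. -/
theorem run_restrict_of_isLastIn (A : AsyncAutomaton D) (t : MTrace D) {C : Set t.E}
    (hC : IsLowerSet C) {i : P} {f : t.E} (h : t.IsLastIn C i f) :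
    A.run (t.restrict C hC) i = A.step (A.run (t.strictPast f)) (t.label f) i := by
  rw [← A.run_restrict_Iic t f, A.run_restrict_congr t (isLowerSet_Iic f) hC]
  · exact fun e he => hC he h.1
  · exact fun e he hne hi => hne (h.2.2 e he hi)

/-- Homomorphisms of automata given by maps of the local state sets preserve runs. -/
theorem run_map (A B : AsyncAutomaton D) (π : ∀ i, A.S i → B.S i)
    (hinit : ∀ i, π i (A.init i) = B.init i)
    (hδ : ∀ a (r : D.LState A.S a) i, π i.1 (A.δ a r i) = B.δ a (fun j => π j.1 (r j)) i)
    (t : MTrace D) (i : P) : π i (A.run t i) = B.run t i := by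
  have hstep : ∀ s a, (fun i => π i (A.step s a i)) = B.step (fun i => π i (s i)) a := by
    intro s a
    funext i
    by_cases h : i ∈ D.loc a
    · simp only [step, dif_pos h]
      exact hδ a _ ⟨i, h⟩
    · simp only [step, dif_neg h]
  have hword : ∀ (w : List Letter) s,
      (fun i => π i (A.runWord s w i)) = B.runWord (fun i => π i (s i)) w := by
    intro w
    induction w with
    | nil => intro s; rfl
    | cons a w ih =>
      intro s
      have := ih (A.step s a)
      rw [hstep] at this
      exact this
  have h0 : (fun i => π i (A.init i)) = B.init := funext hinit
  have := congrFun (hword (t.exists_linearization.choose.map t.label) A.init) i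
  rw [h0] at this
  exact this

end AsyncAutomaton

/-! ### Common predecessors and iterated last events. -/

namespace MTrace

variable {P Letter : Type*} {D : DistAlphabet P Letter}

theorem IsLastIn.mono {t : MTrace D} {C C' : Set t.E} {i : P} {f : t.E} (h : t.IsLastIn C i f)
    (hC : C' ⊆ C) (hf : f ∈ C') : t.IsLastIn C' i f :=
  ⟨hf, h.2.1, fun g hg hi => h.2.2 g (hC hg) hi⟩

theorem isLastIn_Iic_self (t : MTrace D) {i : P} {f : t.E} (h : f ∈ t.procEvents i) :
    t.IsLastIn (Set.Iic f) i f :=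
  ⟨le_rfl, h, fun _ hg _ => hg⟩

/-- The maximal common predecessors of `v` and `f` are last events of processes below `v`, unless
`f` itself is below `v`. -/
theorem le_or_exists_isLastIn (t : MTrace D) {v f x : t.E} (hv : x ≤ v) (hf : x ≤ f) :
    f ≤ v ∨ ∃ s m, t.IsLastIn (Set.Iic v) s m ∧ x ≤ m ∧ m ≤ f := by
  obtain ⟨m, hxm, hm⟩ := (Set.toFinite (Set.Iic v ∩ Set.Iic f)).exists_le_maximal
    (show x ∈ Set.Iic v ∩ Set.Iic f from ⟨hv, hf⟩)
  have hmv : m ≤ v := hm.1.1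
  have hmf : m ≤ f := hm.1.2
  rcases hmf.eq_or_lt with rfl | hlt
  · exact Or.inl hmv
  · obtain ⟨n, hcov, hnf⟩ := exists_covBy_le_of_lt hlt
    obtain ⟨s, hsm, hsn⟩ := t.dep_of_covBy m n hcov
    -- Here `n` covers `m`, lies below `f` and shares the process `s` with `m`. An `s`-event `y ≤ v`
    -- above `m` is comparable to `n`. If `y ≤ n`, then `y` is a common predecessor, so `y ≤ m`. If
    -- `n ≤ y`, then `n` is one, against the maximality of `m`.
    refine Or.inr ⟨s, m, ⟨hmv, hsm, fun y hy hys => ?_⟩, hxm, hmf⟩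
    rcases t.procEvents_total (i := s) hys hsm with h | h
    · exact h
    · rcases t.procEvents_total (i := s) hys hsn with h' | h'
      · exact hm.2 ⟨hy, h'.trans hnf⟩ h
      · exact absurd (hm.2 ⟨h'.trans hy, hnf⟩ hcov.le) hcov.lt.not_ge

/-- An event covered by `e` and above `g` shares a process `k` with `e`. Hence the processes meeting
at `e` jointly know its whole strict past. -/
theorem exists_isLastIn_Iio_ge (t : MTrace D) {e g : t.E} (h : g < e) :
    ∃ k ∈ D.loc (t.label e), ∃ f, t.IsLastIn (Set.Iio e) k f ∧ g ≤ f := by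
  obtain ⟨y, hgy, hcov⟩ := exists_le_covBy_of_lt h
  obtain ⟨k, hky, hke⟩ := t.dep_of_covBy y e hcov
  obtain ⟨f, hf⟩ := t.exists_isLastIn (C := Set.Iio e) (i := k) hcov.lt hky
  exact ⟨k, hke, f, hf, hgy.trans (hf.2.2 y hcov.lt hky)⟩

open Classical in
/-- The last event of process `i` in `C`, if there is one. -/
noncomputable def last (t : MTrace D) (C : Set t.E) (i : P) : Option t.E :=
  if h : ∃ f, t.IsLastIn C i f then some h.choose else none

theorem last_eq_some {t : MTrace D} {C : Set t.E} {i : P} {f : t.E} :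
    t.last C i = some f ↔ t.IsLastIn C i f := by
  unfold last
  split_ifs with h
  · rw [Option.some_inj]
    exact ⟨fun h' => h' ▸ h.choose_spec, fun h' => h.choose_spec.unique h'⟩
  · exact ⟨fun h' => by simp at h', fun h' => absurd ⟨f, h'⟩ h⟩

theorem last_eq_none {t : MTrace D} {C : Set t.E} {i : P} :
    t.last C i = none ↔ ∀ e ∈ C, e ∉ t.procEvents i := by
  rcases t.no_event_or_isLastIn C i with h | ⟨f, hf⟩
  · refine ⟨fun _ => h, fun _ => ?_⟩
    cases h' : t.last C i with
    | none => rfl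
    | some f => exact absurd (last_eq_some.1 h').2.1 (h f (last_eq_some.1 h').1)
  · rw [last_eq_some.2 hf]
    exact ⟨fun h => by simp at h, fun h => absurd hf.2.1 (h f hf.1)⟩

/-- The last event of process `i` in the past of the event `o`, if these exist. -/
noncomputable def lastBelow (t : MTrace D) (o : Option t.E) (i : P) : Option t.E :=
  o.bind fun f => t.last (Set.Iic f) i

theorem lastBelow_eq_some {t : MTrace D} {o : Option t.E} {i : P} {g : t.E} :
    t.lastBelow o i = some g ↔ ∃ f, o = some f ∧ t.IsLastIn (Set.Iic f) i g := by
  simp only [lastBelow, Option.bind_eq_some_iff, last_eq_some]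

theorem lastBelow_some_self {t : MTrace D} {i : P} {f : t.E} (h : f ∈ t.procEvents i) :
    t.lastBelow (some f) i = some f :=
  lastBelow_eq_some.2 ⟨f, rfl, t.isLastIn_Iic_self h⟩

theorem lastBelow_lastBelow_self (t : MTrace D) (o : Option t.E) (i : P) :
    t.lastBelow (t.lastBelow o i) i = t.lastBelow o i := by
  cases h : t.lastBelow o i with
  | none => rfl
  | some g =>
    obtain ⟨f, -, hf⟩ := lastBelow_eq_some.1 h
    exact lastBelow_some_self hf.2.1

theorem lastBelow_last_self (t : MTrace D) (C : Set t.E) (i : P) :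
    t.lastBelow (t.last C i) i = t.last C i := by
  cases h : t.last C i with
  | none => rfl
  | some g => exact lastBelow_some_self (last_eq_some.1 h).2.1

theorem lastBelow_last_of_le {t : MTrace D} {C : Set t.E} (hC : IsLowerSet C) {q k : P}
    {g f : t.E} (hg : t.IsLastIn C q g) (hf : t.IsLastIn C k f) (hgf : g ≤ f) :
    t.lastBelow (t.last C k) q = some g :=
  lastBelow_eq_some.2 ⟨f, last_eq_some.2 hf, hg.mono (fun _ hx => hC hx hf.1) hgf⟩

theorem lastBelow_last_eq_none {t : MTrace D} {C : Set t.E} (hC : IsLowerSet C) {q : P}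
    (h : t.last C q = none) (k : P) : t.lastBelow (t.last C k) q = none := by
  cases h' : t.lastBelow (t.last C k) q with
  | none => rfl
  | some g =>
    obtain ⟨f, hf, hg⟩ := lastBelow_eq_some.1 h'
    exact absurd hg.2.1 (last_eq_none.1 h g (hC hg.1 (last_eq_some.1 hf).1))

theorem lastBelow_some_of_notMem {t : MTrace D} {e : t.E} {q : P} (h : e ∉ t.procEvents q) :
    t.lastBelow (some e) q = t.last (Set.Iio e) q := by
  cases h' : t.last (Set.Iio e) q with
  | none =>
    refine last_eq_none.2 fun f hf hq => ?_
    rcases (show f ≤ e from hf).eq_or_lt with rfl | hlt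
    · exact h hq
    · exact last_eq_none.1 h' f hlt hq
  | some g =>
    have hg := last_eq_some.1 h'
    refine last_eq_some.2 ⟨(show g < e from hg.1).le, hg.2.1, fun f hf hq => ?_⟩
    rcases (show f ≤ e from hf).eq_or_lt with rfl | hlt
    · exact absurd hq h
    · exact hg.2.2 f hlt hq

end MTrace

/-! ### The gossip automaton. -/

namespace Gossip

open MTrace

variable {P Letter : Type*} {D : DistAlphabet P Letter}

/-- Time stamps of events: the letter together with an element of a finite set. -/
abbrev Stamp (P Letter : Type*) := Letter × Fin (Nat.card (P × P × P × P) + 1)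

/-- The gossip information of a process: the time stamps of the last `s`-events before the last
`r`-events before the last `q`-events in its past. -/
abbrev Table (P Letter : Type*) := P → P → P → Option (Stamp P Letter)

section Update

variable {a : Letter}

/-- Pigeonhole: the tables have at most `|P|^4` entries, indexed by `k, q, r, s`, and there is one
more number than that. -/
theorem exists_fresh [Finite P] (σ : D.loc a → Table P Letter) :
    ∃ n, ∀ k q r s, σ k q r s ≠ some (a, n) := by
  classical
  by_contra! h
  choose k q r s h using h
  have hinj : Function.Injective (fun n => ((k n).1, q n, r n, s n)) := by
    intro m n hmn
    simp only [Prod.mk.injEq] at hmn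
    obtain ⟨h1, h2, h3, h4⟩ := hmn
    have h1 : k m = k n := Subtype.ext h1
    have := h m
    rw [h1, h2, h3, h4, h n] at this
    simpa using this.symm
  have := Nat.card_le_card_of_injective _ hinj
  simp only [Nat.card_fin] at this
  omega

open Classical in
/-- A time stamp for an event with label `a` which does not occur in the tables `σ`. -/
noncomputable def fresh (a : Letter) (σ : D.loc a → Table P Letter) : Stamp P Letter :=
  (a, if h : ∃ n, ∀ k q r s, σ k q r s ≠ some (a, n) then h.choose else 0)

theorem ne_fresh [Finite P] (σ : D.loc a → Table P Letter) (k : D.loc a) (q r s : P) :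
    σ k q r s ≠ some (fresh a σ) := by
  have h := exists_fresh σ
  rw [fresh, dif_pos h]
  exact h.choose_spec k q r s

/-- According to the tables `σ`, the process `k` has the latest information about `q`. -/
def Dominates (σ : D.loc a → Table P Letter) (k : D.loc a) (q : P) : Prop :=
  -- The latest `q`-event known to `k'`, if any, reappears as the last `q`-event below the last
  -- `x`-event known to `k`. One level, `x = q`, would not do: `k` may know a later `q`-event.
  ∀ k', σ k' q q q = none ∨ ∃ x, σ k x q q = σ k' q q q

open Classical in
/-- A process having the latest information about `q`. -/
noncomputable def best (σ : D.loc a → Table P Letter) (q : P) : D.loc a :=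
  if h : ∃ k, Dominates σ k q then h.choose
  -- A default value; `exists_dominates` shows that it is not used on tables that arise in a run.
  else ⟨(D.loc_nonempty a).choose, (D.loc_nonempty a).choose_spec⟩

theorem best_dominates {σ : D.loc a → Table P Letter} {q : P} (h : ∃ k, Dominates σ k q) :
    Dominates σ (best σ q) q := by
  rw [best, dif_pos h]
  exact h.choose_spec

open Classical in
/-- The common table of the processes of `a` after an event with label `a`. -/
noncomputable def update (a : Letter) (σ : D.loc a → Table P Letter) : Table P Letter :=
  fun q r s =>
    -- For a process of `a` the last event is now the new event itself. For any other process it is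
    -- unchanged, and is looked up at the best informed participant. Repeated indices pad a shorter
    -- chain of last events.
    if q ∈ D.loc a then
      if r ∈ D.loc a then
        if s ∈ D.loc a then some (fresh a σ) else σ (best σ s) s s s
      else σ (best σ r) r s s
    else σ (best σ q) q r s

open Classical in
/-- The primary order, computed from the tables `σ`. -/
noncomputable def compare (a : Letter) (σ : D.loc a → Table P Letter) : P → P → Bool :=
  -- `e_i ≤ e_j` means that the last `i`-event below `e_j` is `e_i`; the first conjunct excludes
  -- that both sides are `none`.
  fun i j => decide ((σ (best σ i) i i i).isSome ∧ σ (best σ i) i i i = σ (best σ j) j i i)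

end Update

variable [Finite P] [Finite Letter]

/-- Codes of tables, in the lowest universe. -/
noncomputable def code : Table P Letter ≃ Shrink.{0} (Table P Letter) := equivShrink _

/-- The gossip automaton. The tables are replaced by codes, for reasons of universe level. -/
noncomputable def automaton (D : DistAlphabet P Letter) : AsyncTransducer D (P → P → Bool) where
  toAut :=
    { S := fun _ => Shrink.{0} (Table P Letter)
      finite := fun _ => Finite.of_equiv (Table P Letter) code
      δ := fun a r _ => code (update a fun j => code.symm (r j))
      init := fun _ => code fun _ _ _ => none }
  μ a r := compare a fun j => code.symm (r j)

/-- The table of process `k` after the prefix `C` of `t`. -/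
noncomputable def table (t : MTrace D) (C : Set t.E) (hC : IsLowerSet C) (k : P) :
    Table P Letter :=
  code.symm ((automaton D).toAut.run (t.restrict C hC) k)

/-- The tables of the processes of the event `e` before `e`. -/
noncomputable def tablesAt (t : MTrace D) (e : t.E) : D.loc (t.label e) → Table P Letter :=
  fun k => table t (Set.Iio e) (isLowerSet_Iio e) k.1

theorem output_eq (t : MTrace D) (e : t.E) :
    (automaton D).output t e = compare (t.label e) (tablesAt t e) := rfl

theorem table_of_no_event (t : MTrace D) {C : Set t.E} (hC : IsLowerSet C) {k : P}
    (h : ∀ e ∈ C, e ∉ t.procEvents k) : table t C hC k = fun _ _ _ => none := by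
  rw [table, AsyncAutomaton.run_restrict_of_no_event _ t hC h]
  simp [automaton]

theorem table_of_isLastIn (t : MTrace D) {C : Set t.E} (hC : IsLowerSet C) {k : P} {f : t.E}
    (h : t.IsLastIn C k f) : table t C hC k = update (t.label f) (tablesAt t f) := by
  have hk : k ∈ D.loc (t.label f) := h.2.1
  rw [table, AsyncAutomaton.run_restrict_of_isLastIn _ t hC h, AsyncAutomaton.step, dif_pos hk]
  simp only [automaton, Equiv.symm_apply_apply]
  rfl

/-- The time stamp of an event. -/
noncomputable def stamp (t : MTrace D) (e : t.E) : Stamp P Letter :=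
  fresh (t.label e) (tablesAt t e)

/-- The table of the time stamps, for a process with last event `o`. -/
noncomputable def spec (t : MTrace D) (o : Option t.E) : Table P Letter := fun q r s =>
  (t.lastBelow (t.lastBelow (t.lastBelow o q) r) s).map (stamp t)

/-- All tables after events in `C` have the intended contents. -/
def CorrectOn (t : MTrace D) (C : Set t.E) : Prop :=
  ∀ f ∈ C, update (t.label f) (tablesAt t f) = spec t (some f)

theorem CorrectOn.table_eq {t : MTrace D} {C C' : Set t.E} (h : CorrectOn t C) (hC' : IsLowerSet C')
    (hsub : C' ⊆ C) (k : P) : table t C' hC' k = spec t (t.last C' k) := by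
  cases h' : t.last C' k with
  | none =>
    rw [table_of_no_event t hC' (last_eq_none.1 h')]
    rfl
  | some f =>
    have hf := last_eq_some.1 h'
    rw [table_of_isLastIn t hC' hf, h f (hsub hf.1)]

/-- Among the events which are last events of a process before the last event of a process before
the last event of a process in `C`, the time stamps are unique. -/
theorem not_lt_of_stamp_eq {t : MTrace D} {C : Set t.E} (hC : IsLowerSet C) (h : CorrectOn t C)
    {p q r : P} {g g' : t.E} (hg : t.lastBelow (t.lastBelow (t.last C p) q) r = some g)
    (hg' : g' ∈ C) (he : stamp t g = stamp t g') : ¬ g < g' := by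
  intro hlt
  obtain ⟨z, hz, hgz⟩ := lastBelow_eq_some.1 hg
  obtain ⟨f, hf, hzf⟩ := lastBelow_eq_some.1 hz
  have hf := last_eq_some.1 hf
  have hlab : t.label g = t.label g' := congrArg Prod.fst he
  have hr' : r ∈ D.loc (t.label g') := hlab ▸ hgz.2.1
  obtain ⟨v, hv⟩ := t.exists_isLastIn (C := Set.Iio g') (i := r) hlt hgz.2.1
  have hgv : g ≤ v := hv.2.2 g hlt hgz.2.1
  have hvC : v ∈ C := hC (show v < g' from hv.1).le hg'
  -- The stamp of `g'` is fresh with respect to the table that `r` holds just before `g'`, so a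
  -- contradiction arises once `g` occurs in that table. The third level of the tables is needed
  -- here, to reach `g` through `z` by way of a common predecessor of `v` and `f`.
  have key : ∃ x y z, t.lastBelow (t.lastBelow (t.lastBelow (some v) x) y) z = some g := by
    by_cases hzv : z ≤ v
    · have : ∃ s m, t.IsLastIn (Set.Iic v) s m ∧ z ≤ m ∧ m ≤ f := by
        rcases t.le_or_exists_isLastIn hzv (show z ≤ f from hzf.1) with hfv | h'
        · exact ⟨p, f, hf.mono (fun _ hx => hC hx hvC) hfv, hzf.1, le_rfl⟩
        · exact h'
      obtain ⟨s, m, hs, hzm, hmf⟩ := this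
      refine ⟨s, q, r, lastBelow_eq_some.2 ⟨z, lastBelow_eq_some.2 ⟨m, ?_, ?_⟩, hgz⟩⟩
      · exact lastBelow_eq_some.2 ⟨v, rfl, hs⟩
      · exact hzf.mono (Set.Iic_subset_Iic.2 hmf) hzm
    -- When `z` is not below `v`, it is bypassed: a common predecessor of `v` and `z` above `g` has
    -- `g` as its last `r`-event.
    · rcases t.le_or_exists_isLastIn hgv (show g ≤ z from hgz.1) with h' | ⟨s, m, hs, hgm, hmz⟩
      · exact absurd h' hzv
      · refine ⟨s, r, r, ?_⟩
        rw [lastBelow_lastBelow_self]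
        exact lastBelow_eq_some.2 ⟨m, lastBelow_eq_some.2 ⟨v, rfl, hs⟩,
          hgz.mono (Set.Iic_subset_Iic.2 hmz) hgm⟩
  obtain ⟨x, y, z, hxyz⟩ := key
  have ht := h.table_eq (isLowerSet_Iio g') (fun _ hx => hC (le_of_lt hx) hg') r
  have := ne_fresh (tablesAt t g') ⟨r, hr'⟩ x y z
  refine this ?_
  change table t (Set.Iio g') (isLowerSet_Iio g') r x y z = some (stamp t g')
  rw [ht, spec, last_eq_some.2 hv, hxyz, Option.map_some, he]

/-- Equal stamps carry equal letters, so the two events share a process and are comparable;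
`not_lt_of_stamp_eq` excludes both strict orders. -/
theorem eq_of_stamp_eq {t : MTrace D} {C : Set t.E} (hC : IsLowerSet C) (h : CorrectOn t C)
    {p q r p' q' r' : P} {g g' : t.E}
    (hg : t.lastBelow (t.lastBelow (t.last C p) q) r = some g)
    (hg' : t.lastBelow (t.lastBelow (t.last C p') q') r' = some g')
    (he : stamp t g = stamp t g') : g = g' := by
  have mem : ∀ {p q r : P} {g : t.E}, t.lastBelow (t.lastBelow (t.last C p) q) r = some g →
      g ∈ C := by
    intro p q r g hg
    obtain ⟨z, hz, hgz⟩ := lastBelow_eq_some.1 hg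
    obtain ⟨f, hf, hzf⟩ := lastBelow_eq_some.1 hz
    exact hC ((show g ≤ z from hgz.1).trans hzf.1) (last_eq_some.1 hf).1
  have hlab : t.label g = t.label g' := congrArg Prod.fst he
  obtain ⟨k, hk⟩ := D.loc_nonempty (t.label g)
  have hk' : k ∈ D.loc (t.label g') := hlab ▸ hk
  rcases t.procEvents_total (i := k) hk hk' with h' | h'
  · exact h'.eq_or_lt.resolve_right (not_lt_of_stamp_eq hC h hg (mem hg') he)
  · exact (h'.eq_or_lt.resolve_right (not_lt_of_stamp_eq hC h hg' (mem hg) he.symm)).symm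

section AtEvent

variable {t : MTrace D} {e : t.E}

theorem tablesAt_eq (h : CorrectOn t (Set.Iio e)) (k : D.loc (t.label e)) :
    tablesAt t e k = spec t (t.last (Set.Iio e) k.1) :=
  h.table_eq (isLowerSet_Iio e) subset_rfl k.1

/-- If `g` is the last `q`-event before `e`, a participant `k` whose last event `f` lies above `g`
will do. The latest `q`-event `g'` of another participant lies below both last events, and a maximal
common predecessor above `g'` is an entry of `k` with `g'` as its last `q`-event. -/
theorem exists_dominates (h : CorrectOn t (Set.Iio e)) (q : P) :
    ∃ k, Dominates (tablesAt t e) k q := by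
  have hC := isLowerSet_Iio e
  simp only [Dominates, tablesAt_eq h, spec, lastBelow_lastBelow_self]
  cases hq : t.last (Set.Iio e) q with
  | none =>
    obtain ⟨k, hk⟩ := D.loc_nonempty (t.label e)
    refine ⟨⟨k, hk⟩, fun k' => Or.inl ?_⟩
    rw [lastBelow_last_eq_none hC hq]
    rfl
  | some g =>
    have hg := last_eq_some.1 hq
    obtain ⟨k, hk, f, hf, hgf⟩ := t.exists_isLastIn_Iio_ge hg.1
    refine ⟨⟨k, hk⟩, fun k' => ?_⟩
    cases hk' : t.lastBelow (t.last (Set.Iio e) k'.1) q with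
    | none => exact Or.inl rfl
    | some g' =>
      right
      obtain ⟨f', hf', hg'⟩ := lastBelow_eq_some.1 hk'
      have hf' := last_eq_some.1 hf'
      have hgf' : g' ≤ f := (hg.2.2 g' (hC hg'.1 hf'.1) hg'.2.1).trans hgf
      have : ∃ s m, t.IsLastIn (Set.Iic f) s m ∧ g' ≤ m ∧ m ≤ f' := by
        rcases t.le_or_exists_isLastIn hgf' (show g' ≤ f' from hg'.1) with h' | h'
        · exact ⟨k'.1, f', hf'.mono (fun _ hx => hC hx hf.1) h', hg'.1, le_rfl⟩
        · exact h'
      obtain ⟨s, m, hs, hgm, hmf⟩ := this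
      refine ⟨s, congrArg _ ?_⟩
      exact lastBelow_eq_some.2 ⟨m, lastBelow_eq_some.2 ⟨f, last_eq_some.2 hf, hs⟩,
        hg'.mono (Set.Iic_subset_Iic.2 hmf) hgm⟩

/-- Some participant `k0` does know the true last `q`-event `g`. Domination puts the stamp of `g`
into the table of `k`, and by uniqueness of stamps this entry is `g` itself, so `k` knows it too. -/
theorem lastBelow_of_dominates (h : CorrectOn t (Set.Iio e)) {q : P} {k : D.loc (t.label e)}
    (hk : Dominates (tablesAt t e) k q) :
    t.lastBelow (t.last (Set.Iio e) k.1) q = t.last (Set.Iio e) q := by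
  have hC := isLowerSet_Iio e
  cases hq : t.last (Set.Iio e) q with
  | none => exact lastBelow_last_eq_none hC hq _
  | some g =>
    have hg := last_eq_some.1 hq
    obtain ⟨k0, hk0, f0, hf0, hgf0⟩ := t.exists_isLastIn_Iio_ge hg.1
    have h0 := lastBelow_last_of_le hC hg hf0 hgf0
    have hd := hk ⟨k0, hk0⟩
    simp only [tablesAt_eq h, spec, lastBelow_lastBelow_self] at hd
    rw [h0] at hd
    obtain ⟨x, hx⟩ := hd.resolve_left (by simp)
    rw [Option.map_some, Option.map_eq_some_iff] at hx
    obtain ⟨g2, hg2, hs⟩ := hx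
    obtain rfl : g2 = g := eq_of_stamp_eq hC h hg2
      ((lastBelow_lastBelow_self _ _ _).trans h0) hs
    obtain ⟨m, hm, hgm⟩ := lastBelow_eq_some.1 hg2
    obtain ⟨f, hf, hmf⟩ := lastBelow_eq_some.1 hm
    exact lastBelow_last_of_le hC hg (last_eq_some.1 hf) (hgm.1.trans hmf.1)

theorem lastBelow_best (h : CorrectOn t (Set.Iio e)) (q : P) :
    t.lastBelow (t.last (Set.Iio e) (best (tablesAt t e) q).1) q = t.last (Set.Iio e) q :=
  lastBelow_of_dominates h (best_dominates (exists_dominates h q))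

theorem update_eq_spec (h : CorrectOn t (Set.Iio e)) :
    update (t.label e) (tablesAt t e) = spec t (some e) := by
  funext q r s
  have hmem : ∀ {q}, q ∈ D.loc (t.label e) → t.lastBelow (some e) q = some e :=
    fun hq => lastBelow_some_self hq
  have hnot : ∀ {q}, q ∉ D.loc (t.label e) →
      t.lastBelow (some e) q = t.last (Set.Iio e) q := fun hq => lastBelow_some_of_notMem hq
  unfold update
  simp only [tablesAt_eq h, spec, lastBelow_best h, lastBelow_lastBelow_self,
    lastBelow_last_self]
  split_ifs with hq hr hs
  · rw [hmem hq, hmem hr, hmem hs]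
    rfl
  · rw [hmem hq, hmem hr, hnot hs]
  · rw [hmem hq, hnot hr]
  · rw [hnot hq]

end AtEvent

theorem correctOn (t : MTrace D) (C : Set t.E) : CorrectOn t C := fun f _ =>
  t.lt_induction (Q := fun f => update (t.label f) (tablesAt t f) = spec t (some f))
    (fun _ ih => update_eq_spec ih) f

theorem isGossip_automaton : IsGossip (automaton D) := by
  intro t e
  have h := correctOn t (Set.Iio e)
  have hC := isLowerSet_Iio e
  funext i j
  rw [output_eq]
  unfold compare primaryOrder
  rw [decide_eq_decide]
  simp only [tablesAt_eq h, spec, lastBelow_best h, lastBelow_lastBelow_self,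
    lastBelow_last_self, YLe, isLast_iff]
  constructor
  · rintro ⟨h1, h2⟩
    cases hi : t.last (Set.Iio e) i with
    | none => simp [hi] at h1
    | some f =>
      rw [hi, Option.map_some, eq_comm, Option.map_eq_some_iff] at h2
      obtain ⟨f2, hf2, hs⟩ := h2
      obtain rfl : f2 = f := by
        -- Both events are reached from `Set.Iio e` by chains of last events short enough for stamps
        -- to be unique.
        refine eq_of_stamp_eq hC h (p := j) (q := j) (r := i) (p' := i) (q' := i) (r' := i) ?_ ?_ hs
        · rwa [lastBelow_last_self]
        · rwa [lastBelow_last_self, lastBelow_last_self]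
      obtain ⟨g, hg, hfg⟩ := lastBelow_eq_some.1 hf2
      exact ⟨f2, g, last_eq_some.1 hi, last_eq_some.1 hg, hfg.1⟩
  · rintro ⟨f, g, hf, hg, hfg⟩
    rw [lastBelow_last_of_le hC hf hg hfg, last_eq_some.2 hf]
    simp

end Gossip

/-! ### States of the restricted cascade product on prefixes. -/

open MTrace AsyncAutomaton

section CascadeStates

variable {P Letter : Type*} {D : DistAlphabet P Letter} (G : AsyncTransducer D (P → P → Bool))

/-- The component of `A` of the state which the restricted cascade product of `G` and `A` reaches
on the prefix `C` of `t`. -/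
noncomputable def cascadeState (A : AsyncAutomaton (D.prodLabel (P → P → Bool))) (t : MTrace D)
    (C : Set t.E) (hC : IsLowerSet C) : A.Global :=
  fun i => ((G.restrictedCascade A).run (t.restrict C hC) i).2

/-- The state of `A` before the event `e`. -/
noncomputable def cascadeStateAt (A : AsyncAutomaton (D.prodLabel (P → P → Bool))) (t : MTrace D)
    (e : t.E) : A.Global :=
  cascadeState G A t (Set.Iio e) (isLowerSet_Iio e)

/-- The letter of the event `e`, enriched with the primary order. -/
noncomputable def enrichedLabel (t : MTrace D) (e : t.E) : Letter × (P → P → Bool) :=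
  (t.label e, primaryOrder D t e)

/-- The letter of the event `e`, enriched with the primary order and the local states of `A`. -/
noncomputable def enrichedState (A : AsyncAutomaton (D.prodLabel (P → P → Bool))) (t : MTrace D)
    (e : t.E) : Σ x : Letter × (P → P → Bool), (D.prodLabel (P → P → Bool)).LState A.S x :=
  ⟨enrichedLabel t e, A.proj _ (cascadeStateAt G A t e)⟩

variable {G} {A : AsyncAutomaton (D.prodLabel (P → P → Bool))}

theorem restrictedCascade_run_fst (t : MTrace D) (i : P) :
    ((G.restrictedCascade A).run t i).1 = G.toAut.run t i :=
  run_map (G.restrictedCascade A) G.toAut (fun _ x => x.1) (fun _ => rfl) (fun _ _ _ => rfl) t i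

theorem cascadeState_of_no_event (t : MTrace D) {C : Set t.E} (hC : IsLowerSet C) {i : P}
    (h : ∀ e ∈ C, e ∉ t.procEvents i) : cascadeState G A t C hC i = A.init i := by
  rw [cascadeState, run_restrict_of_no_event _ t hC h]
  rfl

/-- The `G`-component runs independently of `A`, so its output at `f` is the primary order, and the
letter read by `A` is the enriched label. From here on `G` matters only through this fact. -/
theorem cascadeState_of_isLastIn (hG : IsGossip G) (t : MTrace D) {C : Set t.E}
    (hC : IsLowerSet C) {i : P} {f : t.E} (h : t.IsLastIn C i f) :
    cascadeState G A t C hC i = A.step (cascadeStateAt G A t f) (enrichedLabel t f) i := by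
  have hi : i ∈ D.loc (t.label f) := h.2.1
  have hout : enrichedLabel t f = (t.label f, G.μ (t.label f) (fun j : D.loc (t.label f) =>
      ((G.restrictedCascade A).run (t.strictPast f) j.1).1)) := by
    rw [enrichedLabel, ← hG t f]
    simp only [restrictedCascade_run_fst]
    rfl
  rw [cascadeState, run_restrict_of_isLastIn _ t hC h, step, dif_pos hi, hout, step,
    dif_pos (show i ∈ (D.prodLabel (P → P → Bool)).loc (t.label f, _) from hi)]
  rfl

theorem cascadeState_localCascade_fst (B : AsyncAutomaton A.outAlphabet) (t : MTrace D)
    (C : Set t.E) (hC : IsLowerSet C) (i : P) :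
    (cascadeState G (A.localCascade B) t C hC i).1 = cascadeState G A t C hC i := by
  have := run_map (G.restrictedCascade (A.localCascade B)) (G.restrictedCascade A)
    (fun _ x => (x.1, x.2.1)) (fun _ => rfl) (fun _ _ _ => rfl) (t.restrict C hC) i
  exact congrArg Prod.snd this

end CascadeStates

/-! ### Reset automata as bits depending on the prefix. -/

section ResetBits

variable {P Letter : Type*} {D : DistAlphabet P Letter}

open Classical in
/-- `b` is the state of process `p` of an automaton with two states, as a function of the prefix,
where events in `ρ₁` reset the state to `false` and events in `ρ₂` reset it to `true`. -/
structure IsResetBit (p : P) (ρ₁ ρ₂ : ∀ t : MTrace D, t.E → Prop) (c : Bool)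
    (b : ∀ (t : MTrace D) (C : Set t.E), IsLowerSet C → Bool) : Prop where
  of_no_event : ∀ t C hC, (∀ e ∈ C, e ∉ t.procEvents p) → b t C hC = c
  of_isLastIn : ∀ t C hC f, t.IsLastIn C p f →
    b t C hC = if ρ₁ t f then false else if ρ₂ t f then true
      else b t (Set.Iio f) (isLowerSet_Iio f)

variable {p : P} {ρ₁ ρ₂ : ∀ t : MTrace D, t.E → Prop} {c : Bool}
  {b : ∀ (t : MTrace D) (C : Set t.E), IsLowerSet C → Bool}

/-- Induction along the `p`-events. The conjunct `¬ ρ₁ t f` reflects that `ρ₁` takes precedence when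
both conditions hold. -/
theorem IsResetBit.eq_true_iff (hb : IsResetBit p ρ₁ ρ₂ c b) (t : MTrace D) (C : Set t.E)
    (hC : IsLowerSet C) :
    b t C hC = true ↔
      (∃ f ∈ C, f ∈ t.procEvents p ∧ (ρ₂ t f ∧ ¬ ρ₁ t f) ∧
        ∀ g ∈ C, g ∈ t.procEvents p → f < g → ¬ ρ₁ t g) ∨
      (c = true ∧ ∀ g ∈ C, g ∈ t.procEvents p → ¬ ρ₁ t g) := by
  classical
  induction C, hC using t.prefix_induction p with
  | zero C hC h =>
    rw [hb.of_no_event t C hC h]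
    constructor
    · exact fun hc => Or.inr ⟨hc, fun g hg hp => absurd hp (h g hg)⟩
    · rintro (⟨f, hf, hp, -⟩ | ⟨hc, -⟩)
      · exact absurd hp (h f hf)
      · exact hc
  | succ C hC f hf ih =>
    rw [hb.of_isLastIn t C hC f hf]
    have hlt : ∀ g ∈ C, g ∈ t.procEvents p → g = f ∨ g < f := fun g hg hp =>
      (hf.2.2 g hg hp).eq_or_lt
    by_cases h1 : ρ₁ t f
    · rw [if_pos h1]
      refine iff_of_false (by simp) ?_
      rintro (⟨g, hg, hp, ⟨-, hn⟩, h⟩ | ⟨-, h⟩)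
      · rcases hlt g hg hp with rfl | hgf
        · exact hn h1
        · exact h f hf.1 hf.2.1 hgf h1
      · exact h f hf.1 hf.2.1 h1
    · rw [if_neg h1]
      by_cases h2 : ρ₂ t f
      · rw [if_pos h2]
        exact iff_of_true rfl (Or.inl ⟨f, hf.1, hf.2.1, ⟨h2, h1⟩,
          fun g hg hp hfg => absurd hfg (hf.2.2 g hg hp).not_gt⟩)
      · rw [if_neg h2, ih]
        refine or_congr ⟨?_, ?_⟩ (and_congr_right fun _ => ⟨?_, ?_⟩)
        · rintro ⟨g, hg, hp, hr, h⟩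
          refine ⟨g, hC (le_of_lt hg) hf.1, hp, hr, fun x hx hxp hgx => ?_⟩
          rcases hlt x hx hxp with rfl | hxf
          · exact h1
          · exact h x hxf hxp hgx
        · rintro ⟨g, hg, hp, hr, h⟩
          rcases hlt g hg hp with rfl | hgf
          · exact absurd hr.1 h2
          · exact ⟨g, hgf, hp, hr, fun x hx => h x (hC (le_of_lt hx) hf.1)⟩
        · intro h x hx hxp
          rcases hlt x hx hxp with rfl | hxf
          · exact h1
          · exact h x hxf hxp
        · exact fun h x hx => h x (hC (le_of_lt hx) hf.1)

/-- A reset automaton can be used to evaluate a since operator. -/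
theorem IsResetBit.eq_true_iff_since (hb : IsResetBit p ρ₁ ρ₂ false b)
    {φ ψ : ∀ t : MTrace D, t.E → Prop}
    (h1 : ∀ t, ∀ e ∈ t.procEvents p, ρ₁ t e ↔ ¬ ψ t e ∧ ¬ φ t e)
    (h2 : ∀ t, ∀ e ∈ t.procEvents p, ρ₂ t e ↔ ψ t e) (t : MTrace D) (C : Set t.E)
    (hC : IsLowerSet C) :
    b t C hC = true ↔ ∃ f ∈ C, f ∈ t.procEvents p ∧ ψ t f ∧
      ∀ g ∈ C, g ∈ t.procEvents p → f < g → φ t g := by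
  classical
  rw [hb.eq_true_iff]
  simp only [Bool.false_eq_true, false_and, or_false]
  constructor
  · rintro ⟨f, hf, hfp, ⟨hψ, -⟩, h⟩
    -- After `f` there may be events with `ψ` but not `φ`, which do not reset the bit to false. The
    -- latest `ψ`-event is therefore the right witness: beyond it, not being reset to false means
    -- `φ`.
    obtain ⟨m, hfm, hm⟩ := (Set.toFinite {x | x ∈ C ∧ x ∈ t.procEvents p ∧ ψ t x}).exists_le_maximal
      (show f ∈ {x | x ∈ C ∧ x ∈ t.procEvents p ∧ ψ t x} from ⟨hf, hfp, (h2 t f hfp).1 hψ⟩)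
    refine ⟨m, hm.1.1, hm.1.2.1, hm.1.2.2, fun g hg hgp hmg => ?_⟩
    by_contra hφ
    refine h g hg hgp (hfm.trans_lt hmg) ((h1 t g hgp).2 ⟨fun hψg => ?_, hφ⟩)
    exact hmg.not_ge (hm.2 ⟨hg, hgp, hψg⟩ hmg.le)
  · rintro ⟨f, hf, hfp, hψ, h⟩
    refine ⟨f, hf, hfp, ⟨(h2 t f hfp).2 hψ, fun hr => ((h1 t f hfp).1 hr).1 hψ⟩, ?_⟩
    exact fun g hg hgp hfg hr => ((h1 t g hgp).1 hr).2 (h g hg hgp hfg)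

variable {G : AsyncTransducer D (P → P → Bool)} {A : AsyncAutomaton (D.prodLabel (P → P → Bool))}

theorem isResetBit_U2 (hG : IsGossip G) (p : P) (R₁ R₂ : Set (Letter × (P → P → Bool)))
    (c : Bool) :
    IsResetBit p (fun t e => enrichedLabel t e ∈ R₁) (fun t e => enrichedLabel t e ∈ R₂) c
      (fun t C hC => cascadeState G (U2 (D.prodLabel (P → P → Bool)) p R₁ R₂ c) t C hC p rfl) where
  of_no_event t C hC h := by
    rw [cascadeState_of_no_event t hC h]
    rfl
  of_isLastIn t C hC f h := by
    have hp : p ∈ (D.prodLabel (P → P → Bool)).loc (enrichedLabel t f) := h.2.1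
    rw [cascadeState_of_isLastIn hG t hC h, step, dif_pos hp]
    rfl

theorem isResetBit_cascade (hG : IsGossip G) (p : P)
    (R₁ R₂ : Set (Σ x : Letter × (P → P → Bool), (D.prodLabel (P → P → Bool)).LState A.S x))
    (c : Bool) :
    IsResetBit p (fun t e => enrichedState G A t e ∈ R₁) (fun t e => enrichedState G A t e ∈ R₂) c
      (fun t C hC =>
        (cascadeState G (A.localCascade (U2 A.outAlphabet p R₁ R₂ c)) t C hC p).2 rfl) where
  of_no_event t C hC h := by
    rw [cascadeState_of_no_event t hC h]
    rfl
  of_isLastIn t C hC f h := by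
    have hp : p ∈ (D.prodLabel (P → P → Bool)).loc (enrichedLabel t f) := h.2.1
    have hs : enrichedState G A t f = ⟨enrichedLabel t f, fun j =>
        (cascadeStateAt G (A.localCascade (U2 A.outAlphabet p R₁ R₂ c)) t f j.1).1⟩ := by
      simp only [cascadeStateAt, cascadeState_localCascade_fst]
      rfl
    classical
    -- The last factor reads the first components of the product state; `hs` identifies this letter
    -- with `enrichedState G A t f`, and `key` transports the reset rule along that equality.
    have key : ∀ (q : Bool) y, enrichedState G A t f = y →
        (if y ∈ R₁ then false else if y ∈ R₂ then true else q) =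
          if enrichedState G A t f ∈ R₁ then false
          else if enrichedState G A t f ∈ R₂ then true else q := by
      rintro q _ rfl
      rfl
    have hstep := cascadeState_of_isLastIn
      (A := A.localCascade (U2 A.outAlphabet p R₁ R₂ c)) hG t hC h
    rw [step, dif_pos hp] at hstep
    exact (congrArg (fun s : A.S p × (p = p → Bool) => s.2 rfl) hstep).trans (key _ _ hs)

end ResetBits

/-! ### From formulas to cascades. -/

section FormulaToAutomaton

variable {P Letter : Type*} {D : DistAlphabet P Letter}

/-- The states of `A` are functions of the states of `A'`. -/
def Refines (G : AsyncTransducer D (P → P → Bool))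
    (A A' : AsyncAutomaton (D.prodLabel (P → P → Bool))) : Prop :=
  ∃ π : ∀ i, A'.S i → A.S i, ∀ t C hC i,
    π i (cascadeState G A' t C hC i) = cascadeState G A t C hC i

/-- The truth value of `φ` at an event is a function of the enriched letter of the event and the
local states of `A` before it. -/
def Evaluates (G : AsyncTransducer D (P → P → Bool))
    (A : AsyncAutomaton (D.prodLabel (P → P → Bool))) (φ : ∀ t : MTrace D, t.E → Prop) : Prop :=
  ∃ R : Set (Σ x : Letter × (P → P → Bool), (D.prodLabel (P → P → Bool)).LState A.S x),
    ∀ t e, φ t e ↔ enrichedState G A t e ∈ R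

variable {G : AsyncTransducer D (P → P → Bool)}
  {A A' A'' : AsyncAutomaton (D.prodLabel (P → P → Bool))}

theorem Refines.refl (A : AsyncAutomaton (D.prodLabel (P → P → Bool))) : Refines G A A :=
  ⟨fun _ x => x, fun _ _ _ _ => rfl⟩

theorem Refines.trans (h : Refines G A A') (h' : Refines G A' A'') : Refines G A A'' := by
  obtain ⟨π, hπ⟩ := h
  obtain ⟨π', hπ'⟩ := h'
  exact ⟨fun i x => π i (π' i x), fun t C hC i =>
    (congrArg (π i) (hπ' t C hC i)).trans (hπ t C hC i)⟩

theorem refines_localCascade (B : AsyncAutomaton A.outAlphabet) :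
    Refines G A (A.localCascade B) :=
  ⟨fun _ x => x.1, cascadeState_localCascade_fst B⟩

theorem Evaluates.of_refines {φ : ∀ t : MTrace D, t.E → Prop} (h : Evaluates G A φ)
    (h' : Refines G A A') : Evaluates G A' φ := by
  obtain ⟨R, hR⟩ := h
  obtain ⟨π, hπ⟩ := h'
  refine ⟨{x | ⟨x.1, fun j => π j.1 (x.2 j)⟩ ∈ R}, fun t e => ?_⟩
  have : enrichedState G A t e =
      ⟨(enrichedState G A' t e).1, fun j => π j.1 ((enrichedState G A' t e).2 j)⟩ := by
    simp only [enrichedState, proj, cascadeStateAt, hπ]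
    rfl
  rw [hR, this]
  rfl

/-- One more factor `U_2[p]` suffices: its input letters show whether `φ` and `ψ` hold at the
current event. Stating the result for all prefixes serves both strict pasts, for since, and whole
traces, for `∃_p`. -/
theorem exists_cascade_evaluates_since (hG : IsGossip G) (hA : IsU2Cascade A) (p : P)
    {φ ψ : ∀ t : MTrace D, t.E → Prop} (hφ : Evaluates G A φ) (hψ : Evaluates G A ψ) :
    ∃ A', IsU2Cascade A' ∧ Refines G A A' ∧ ∃ β : A'.S p → Prop, ∀ t C hC,
      β (cascadeState G A' t C hC p) ↔ ∃ f ∈ C, f ∈ t.procEvents p ∧ ψ t f ∧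
        ∀ g ∈ C, g ∈ t.procEvents p → f < g → φ t g := by
  obtain ⟨R, hR⟩ := hφ
  obtain ⟨R', hR'⟩ := hψ
  let R₁ : Set (Σ x : Letter × (P → P → Bool), (D.prodLabel (P → P → Bool)).LState A.S x) :=
    {x | p ∈ D.loc x.1.1 ∧ x ∉ R' ∧ x ∉ R}
  let R₂ : Set (Σ x : Letter × (P → P → Bool), (D.prodLabel (P → P → Bool)).LState A.S x) :=
    {x | p ∈ D.loc x.1.1 ∧ x ∈ R'}
  refine ⟨_, IsU2Cascade.cascade A hA p R₁ R₂ false (fun x hx => hx.1) (fun x hx => hx.1) ?_,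
    refines_localCascade _, fun s => s.2 rfl = true, fun t C hC => ?_⟩
  · exact Set.disjoint_left.2 fun x h1 h2 => h1.2.1 h2.2
  · refine (isResetBit_cascade hG p R₁ R₂ false).eq_true_iff_since (φ := φ) (ψ := ψ) ?_ ?_ t C hC
    · intro t e he
      rw [hR, hR']
      exact ⟨fun h => h.2, fun h => ⟨he, h⟩⟩
    · intro t e he
      rw [hR']
      exact ⟨fun h => h.2, fun h => ⟨he, h⟩⟩

/-- The cascade `A` to be extended is arbitrary, so that two subformulas can be treated one after
the other on a single cascade; values computed by `A` survive in a refinement. -/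
theorem exists_cascade_evaluates (hG : IsGossip G) (φ : EventFormula P Letter)
    (A : AsyncAutomaton (D.prodLabel (P → P → Bool))) (hA : IsU2Cascade A) :
    ∃ A', IsU2Cascade A' ∧ Refines G A A' ∧ Evaluates G A' (fun t e => φ.Sat t e) := by
  induction φ generalizing A with
  | letter a =>
    exact ⟨A, hA, Refines.refl A, {x | x.1.1 = a}, fun t e => Iff.rfl⟩
  | neg φ ih =>
    obtain ⟨A', hA', hr, R, hR⟩ := ih A hA
    exact ⟨A', hA', hr, Rᶜ, fun t e => not_congr (hR t e)⟩
  | or φ ψ ih ih' =>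
    obtain ⟨A', hA', hr, h⟩ := ih A hA
    obtain ⟨A'', hA'', hr', R', hR'⟩ := ih' A' hA'
    obtain ⟨R, hR⟩ := h.of_refines hr'
    exact ⟨A'', hA'', hr.trans hr', R ∪ R', fun t e => or_congr (hR t e) (hR' t e)⟩
  | yle i j =>
    refine ⟨A, hA, Refines.refl A, {x | x.1.2 i j = true}, fun t e => ?_⟩
    simp [EventFormula.Sat, enrichedState, enrichedLabel, primaryOrder]
  | since p φ ψ ih ih' =>
    obtain ⟨A', hA', hr, h⟩ := ih A hA
    obtain ⟨A'', hA'', hr', h'⟩ := ih' A' hA'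
    obtain ⟨B, hB, hrB, β, hβ⟩ := exists_cascade_evaluates_since hG hA'' p (h.of_refines hr') h'
    refine ⟨B, hB, (hr.trans hr').trans hrB,
      {x | ∃ hp : p ∈ D.loc x.1.1, β (x.2 ⟨p, hp⟩)}, fun t e => ?_⟩
    have := hβ t (Set.Iio e) (isLowerSet_Iio e)
    constructor
    · rintro ⟨he, f, hf, hfe, hψ, h⟩
      exact ⟨he, this.2 ⟨f, hfe, hf, hψ, fun g hg hgp hfg => h g hgp hfg hg⟩⟩
    · rintro ⟨he, h⟩
      obtain ⟨f, hfe, hf, hψ, h⟩ := this.1 h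
      exact ⟨he, f, hf, hfe, hψ, fun g hgp hfg hg => h g hg hgp hfg⟩

theorem exists_cascade_accepts (hG : IsGossip G) (β : TraceFormula P Letter)
    (A : AsyncAutomaton (D.prodLabel (P → P → Bool))) (hA : IsU2Cascade A) :
    ∃ A', IsU2Cascade A' ∧ Refines G A A' ∧ ∃ F : Set A'.Global, ∀ t,
      β.Sat t ↔ cascadeState G A' t Set.univ isLowerSet_univ ∈ F := by
  induction β generalizing A with
  | ex p φ =>
    obtain ⟨A', hA', hr, h⟩ := exists_cascade_evaluates hG φ A hA
    -- On the whole trace, "false since `φ`" along `p` says that the last `p`-event satisfies `φ`.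
    have hfalse : Evaluates G A' (fun _ _ => False) := ⟨∅, fun _ _ => Iff.rfl⟩
    obtain ⟨B, hB, hrB, β, hβ⟩ := exists_cascade_evaluates_since hG hA' p hfalse h
    refine ⟨B, hB, hr.trans hrB, {s | β (s p)}, fun t => ?_⟩
    refine Iff.trans ?_ (hβ t Set.univ isLowerSet_univ).symm
    constructor
    · rintro ⟨e, he, hφ⟩
      exact ⟨e, trivial, he.1, hφ, fun g _ hg heg => heg.not_ge (he.2 hg heg.le)⟩
    · rintro ⟨e, -, he, hφ, h⟩
      refine ⟨e, ⟨he, fun g hg heg => ?_⟩, hφ⟩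
      by_contra hn
      exact h g trivial hg (lt_of_le_not_ge heg hn)
  | neg β ih =>
    obtain ⟨A', hA', hr, F, hF⟩ := ih A hA
    exact ⟨A', hA', hr, Fᶜ, fun t => not_congr (hF t)⟩
  | or β β' ih ih' =>
    obtain ⟨A', hA', hr, F, hF⟩ := ih A hA
    obtain ⟨A'', hA'', ⟨π, hπ⟩, F', hF'⟩ := ih' A' hA'
    refine ⟨A'', hA'', hr.trans ⟨π, hπ⟩, {s | (fun i => π i (s i)) ∈ F} ∪ F', fun t => ?_⟩
    refine or_congr ?_ (hF' t)
    rw [hF]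
    simp only [Set.mem_ofPred_eq, hπ]

theorem TraceFormula.nonempty_process (β : TraceFormula P Letter) : Nonempty P := by
  induction β with
  | ex p φ => exact ⟨p⟩
  | neg β ih => exact ih
  | or β β' ih ih' => exact ih

theorem mem_accepting_iff (F : Set A.Global) (t : MTrace D) :
    (G.restrictedCascade A).run t ∈ {r | (fun i => (r i).2) ∈ F} ↔
      cascadeState G A t Set.univ isLowerSet_univ ∈ F := by
  rw [run_eq_run_restrict_univ]
  rfl

theorem acceptedByRestrictedU2Cascade_of_definable (hG : IsGossip G) {L : Set (MTrace D)}
    (h : LocTLDefinable L) : AcceptedByRestrictedU2Cascade G L := by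
  obtain ⟨β, rfl⟩ := h
  obtain ⟨p⟩ := β.nonempty_process
  -- A cascade has at least one factor, so the construction starts from one that never resets, on a
  -- process occurring in the formula.
  obtain ⟨A, hA, -, F, hF⟩ := exists_cascade_accepts hG β _
    (IsU2Cascade.single (D := D.prodLabel (P → P → Bool)) p ∅ ∅ false (by simp) (by simp)
      (by simp))
  refine ⟨A, hA, F, ?_⟩
  ext t
  exact (hF t).trans (mem_accepting_iff F t).symm

end FormulaToAutomaton

/-! ### From cascades to formulas. -/

section AutomatonToFormula

variable {P Letter : Type*} {D : DistAlphabet P Letter}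

/-- The property `φ` of events is expressed by an event formula. -/
def EventDefinable (φ : ∀ t : MTrace D, t.E → Prop) : Prop :=
  ∃ α : EventFormula P Letter, ∀ t e, α.Sat t e ↔ φ t e

/-- The property `φ` of traces is expressed by a trace formula. -/
def TraceDefinable (φ : MTrace D → Prop) : Prop :=
  ∃ β : TraceFormula P Letter, ∀ t, β.Sat t ↔ φ t

namespace EventDefinable

variable {φ ψ : ∀ t : MTrace D, t.E → Prop}

theorem congr (h : EventDefinable φ) (h' : ∀ t e, φ t e ↔ ψ t e) : EventDefinable ψ := by
  obtain ⟨α, hα⟩ := h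
  exact ⟨α, fun t e => (hα t e).trans (h' t e)⟩

theorem not (h : EventDefinable φ) : EventDefinable (fun t e => ¬ φ t e) := by
  obtain ⟨α, hα⟩ := h
  exact ⟨.neg α, fun t e => not_congr (hα t e)⟩

theorem or (h : EventDefinable φ) (h' : EventDefinable ψ) :
    EventDefinable (fun t e => φ t e ∨ ψ t e) := by
  obtain ⟨α, hα⟩ := h
  obtain ⟨α', hα'⟩ := h'
  exact ⟨.or α α', fun t e => or_congr (hα t e) (hα' t e)⟩

theorem and (h : EventDefinable φ) (h' : EventDefinable ψ) :
    EventDefinable (fun t e => φ t e ∧ ψ t e) :=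
  (h.not.or h'.not).not.congr fun t e => by tauto

/-- The syntax has no truth constants; they arise as `α ∨ ¬α` and `α ∧ ¬α` from an atom `Y_{p ≤ p}`,
which is why a process is needed. -/
theorem const [Nonempty P] (q : Prop) : EventDefinable (D := D) (fun _ _ => q) := by
  obtain ⟨p⟩ := ‹Nonempty P›
  have h : EventDefinable (D := D) (fun t e => t.YLe e p p) := ⟨.yle p p, fun _ _ => Iff.rfl⟩
  by_cases hq : q
  · exact (h.or h.not).congr fun t e => by tauto
  · exact (h.and h.not).congr fun t e => by tauto

theorem exists_finite [Nonempty P] {ι : Type*} [Finite ι] {φ : ι → ∀ t : MTrace D, t.E → Prop}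
    (h : ∀ x, EventDefinable (φ x)) : EventDefinable (fun t e => ∃ x, φ x t e) := by
  classical
  cases nonempty_fintype ι
  have key : ∀ s : Finset ι, EventDefinable (fun t e => ∃ x ∈ s, φ x t e) := by
    intro s
    induction s using Finset.induction_on with
    | empty => exact (const False).congr fun t e => by simp
    | insert x s _ ih => exact ((h x).or ih).congr fun t e => by simp
  exact (key Finset.univ).congr fun t e => by simp

theorem forall_finite [Nonempty P] {ι : Type*} [Finite ι] {φ : ι → ∀ t : MTrace D, t.E → Prop}
    (h : ∀ x, EventDefinable (φ x)) : EventDefinable (fun t e => ∀ x, φ x t e) :=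
  (exists_finite fun x => (h x).not).not.congr fun t e => by simp

theorem letter (a : Letter) : EventDefinable (D := D) (fun t e => t.label e = a) :=
  ⟨.letter a, fun _ _ => Iff.rfl⟩

theorem mem_procEvents [Nonempty P] [Finite Letter] (p : P) :
    EventDefinable (D := D) (fun t e => e ∈ t.procEvents p) :=
  (exists_finite fun a => (const (p ∈ D.loc a)).and (letter a)).congr fun t e => by
    simp [procEvents]

theorem since (p : P) (h : EventDefinable φ) (h' : EventDefinable ψ) :
    EventDefinable (fun t e => e ∈ t.procEvents p ∧ ∃ f ∈ t.procEvents p, f < e ∧ ψ t f ∧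
      ∀ g ∈ t.procEvents p, f < g → g < e → φ t g) := by
  obtain ⟨α, hα⟩ := h
  obtain ⟨α', hα'⟩ := h'
  exact ⟨.since p α α', fun t e => by simp only [EventFormula.Sat, hα, hα']⟩

theorem enrichedLabel_eq [Nonempty P] [Finite P] (x : Letter × (P → P → Bool)) :
    EventDefinable (D := D) (fun t e => enrichedLabel t e = x) := by
  have hY : ∀ i j, EventDefinable (D := D) (fun t e => t.YLe e i j ↔ x.2 i j = true) := by
    intro i j
    have h : EventDefinable (D := D) (fun t e => t.YLe e i j) := ⟨.yle i j, fun _ _ => Iff.rfl⟩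
    by_cases hx : x.2 i j = true
    · exact h.congr fun t e => by simp [hx]
    · exact h.not.congr fun t e => by simp [hx]
  refine ((letter x.1).and (forall_finite fun i => forall_finite fun j => hY i j)).congr
    fun t e => ?_
  obtain ⟨a, γ⟩ := x
  simp only [enrichedLabel, Prod.mk.injEq]
  refine and_congr_right fun _ => ?_
  constructor
  · intro h
    funext i j
    rw [Bool.eq_iff_iff, ← h i j]
    simp [primaryOrder]
  · rintro rfl i j
    simp [primaryOrder]

end EventDefinable

namespace TraceDefinable

variable {φ ψ : MTrace D → Prop}

theorem congr (h : TraceDefinable φ) (h' : ∀ t, φ t ↔ ψ t) : TraceDefinable ψ := by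
  obtain ⟨β, hβ⟩ := h
  exact ⟨β, fun t => (hβ t).trans (h' t)⟩

theorem not (h : TraceDefinable φ) : TraceDefinable (fun t => ¬ φ t) := by
  obtain ⟨β, hβ⟩ := h
  exact ⟨.neg β, fun t => not_congr (hβ t)⟩

theorem or (h : TraceDefinable φ) (h' : TraceDefinable ψ) :
    TraceDefinable (fun t => φ t ∨ ψ t) := by
  obtain ⟨β, hβ⟩ := h
  obtain ⟨β', hβ'⟩ := h'
  exact ⟨.or β β', fun t => or_congr (hβ t) (hβ' t)⟩

theorem and (h : TraceDefinable φ) (h' : TraceDefinable ψ) :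
    TraceDefinable (fun t => φ t ∧ ψ t) :=
  (h.not.or h'.not).not.congr fun t => by tauto

theorem ex (p : P) {φ : ∀ t : MTrace D, t.E → Prop} (h : EventDefinable φ) :
    TraceDefinable (fun t => ∃ e, t.IsLastIn Set.univ p e ∧ φ t e) := by
  obtain ⟨α, hα⟩ := h
  refine ⟨.ex p α, fun t => ?_⟩
  simp only [TraceFormula.Sat, hα, isLastIn_iff_maximal, Set.univ_inter]

theorem const [Nonempty P] (q : Prop) : TraceDefinable (D := D) (fun _ => q) := by
  obtain ⟨p⟩ := ‹Nonempty P›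
  have h : TraceDefinable (D := D) _ := ex p (EventDefinable.const True)
  by_cases hq : q
  · exact (h.or h.not).congr fun t => by tauto
  · exact (h.and h.not).congr fun t => ⟨fun h' => absurd h'.1 h'.2, fun h' => absurd h' hq⟩

theorem exists_finite [Nonempty P] {ι : Type*} [Finite ι] {φ : ι → MTrace D → Prop}
    (h : ∀ x, TraceDefinable (φ x)) : TraceDefinable (fun t => ∃ x, φ x t) := by
  classical
  cases nonempty_fintype ι
  have key : ∀ s : Finset ι, TraceDefinable (fun t => ∃ x ∈ s, φ x t) := by
    intro s
    induction s using Finset.induction_on with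
    | empty => exact (const False).congr fun t => by simp
    | insert x s _ ih => exact ((h x).or ih).congr fun t => by simp
  exact (key Finset.univ).congr fun t => by simp

theorem forall_finite [Nonempty P] {ι : Type*} [Finite ι] {φ : ι → MTrace D → Prop}
    (h : ∀ x, TraceDefinable (φ x)) : TraceDefinable (fun t => ∀ x, φ x t) :=
  (exists_finite fun x => (h x).not).not.congr fun t => by simp

end TraceDefinable

variable [Finite Letter] [Nonempty P]

/-- At a `p`-event the formula is `(¬ρ₁ S_p (ρ₂ ∧ ¬ρ₁)) ∨ (c ∧ ¬(⊤ S_p ρ₁))`, by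
`IsResetBit.eq_true_iff` on the strict past. The restriction to `p`-events is forced, since `S_p` is
false elsewhere. -/
theorem IsResetBit.eventDefinable {p : P} {ρ₁ ρ₂ : ∀ t : MTrace D, t.E → Prop} {c : Bool}
    {b : ∀ (t : MTrace D) (C : Set t.E), IsLowerSet C → Bool} (hb : IsResetBit p ρ₁ ρ₂ c b)
    (h₁ : EventDefinable ρ₁) (h₂ : EventDefinable ρ₂) :
    EventDefinable (fun t e => e ∈ t.procEvents p ∧
      b t (Set.Iio e) (isLowerSet_Iio e) = true) := by
  refine ((EventDefinable.mem_procEvents p).and ((h₁.not.since p (h₂.and h₁.not)).or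
    ((EventDefinable.const (c = true)).and ((EventDefinable.const True).since p h₁).not))).congr
    fun t e => and_congr_right fun he => ?_
  rw [hb.eq_true_iff]
  refine or_congr ?_ (and_congr_right fun _ => ?_)
  · constructor
    · rintro ⟨-, f, hf, hfe, h, h'⟩
      exact ⟨f, hfe, hf, h, fun g hg hgp hfg => h' g hgp hfg hg⟩
    · rintro ⟨f, hfe, hf, h, h'⟩
      exact ⟨he, f, hf, hfe, h, fun g hgp hfg hg => h' g hg hgp hfg⟩
  · constructor
    · exact fun h g hg hgp hr => h ⟨he, g, hgp, hg, hr, fun _ _ _ _ => trivial⟩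
    · rintro h ⟨-, g, hgp, hg, hr, -⟩
      exact h g hg hgp hr

/-- At the last `p`-event the bit before it is already expressible, and one update remains: `¬ρ₁ ∧
(ρ₂ ∨ bit)`. Without `p`-events the bit is `c`. -/
theorem IsResetBit.traceDefinable {p : P} {ρ₁ ρ₂ : ∀ t : MTrace D, t.E → Prop} {c : Bool}
    {b : ∀ (t : MTrace D) (C : Set t.E), IsLowerSet C → Bool} (hb : IsResetBit p ρ₁ ρ₂ c b)
    (h₁ : EventDefinable ρ₁) (h₂ : EventDefinable ρ₂) :
    TraceDefinable (fun t => b t Set.univ isLowerSet_univ = true) := by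
  classical
  refine ((TraceDefinable.ex p (h₁.not.and (h₂.or (hb.eventDefinable h₁ h₂)))).or
    ((TraceDefinable.const (c = true)).and
      (TraceDefinable.ex p (EventDefinable.const True)).not)).congr fun t => ?_
  rcases t.no_event_or_isLastIn Set.univ p with h | ⟨f, hf⟩
  · have hno : ∀ e, ¬ t.IsLastIn Set.univ p e := fun e he => h e he.1 he.2.1
    rw [hb.of_no_event t _ _ h]
    simp [hno]
  · have hlast : ∀ e, t.IsLastIn Set.univ p e ↔ e = f :=
      fun e => ⟨fun he => he.unique hf, fun he => he ▸ hf⟩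
    rw [hb.of_isLastIn t _ _ f hf]
    simp only [hlast, exists_eq_left, hf.2.1, true_and, and_true]
    by_cases hr₁ : ρ₁ t f
    · simp [hr₁]
    · by_cases hr₂ : ρ₂ t f <;> simp [hr₁, hr₂]

theorem IsResetBit.eventDefinable_eq {p : P} {ρ₁ ρ₂ : ∀ t : MTrace D, t.E → Prop} {c : Bool}
    {b : ∀ (t : MTrace D) (C : Set t.E), IsLowerSet C → Bool} (hb : IsResetBit p ρ₁ ρ₂ c b)
    (h₁ : EventDefinable ρ₁) (h₂ : EventDefinable ρ₂) (v : Bool) :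
    EventDefinable (fun t e => e ∈ t.procEvents p ∧ b t (Set.Iio e) (isLowerSet_Iio e) = v) := by
  cases v with
  | true => exact hb.eventDefinable h₁ h₂
  | false =>
    refine ((EventDefinable.mem_procEvents p).and (hb.eventDefinable h₁ h₂).not).congr
      fun t e => and_congr_right fun he => ?_
    simp [he]

theorem IsResetBit.traceDefinable_eq {p : P} {ρ₁ ρ₂ : ∀ t : MTrace D, t.E → Prop} {c : Bool}
    {b : ∀ (t : MTrace D) (C : Set t.E), IsLowerSet C → Bool} (hb : IsResetBit p ρ₁ ρ₂ c b)
    (h₁ : EventDefinable ρ₁) (h₂ : EventDefinable ρ₂) (v : Bool) :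
    TraceDefinable (fun t => b t Set.univ isLowerSet_univ = v) := by
  cases v with
  | true => exact hb.traceDefinable h₁ h₂
  | false => exact (hb.traceDefinable h₁ h₂).not.congr fun t => by simp

/-- All local states of `A` are expressed by formulas. -/
structure StatesDefinable (G : AsyncTransducer D (P → P → Bool))
    (A : AsyncAutomaton (D.prodLabel (P → P → Bool))) : Prop where
  event : ∀ i s, EventDefinable (fun t e => e ∈ t.procEvents i ∧ cascadeStateAt G A t e i = s)
  trace : ∀ i s,
    TraceDefinable (fun t => cascadeState G A t Set.univ isLowerSet_univ i = s)

/-- A finite disjunction over the elements of `R`. Only states of processes taking part in the event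
are involved, and these are the ones that `StatesDefinable.event` describes. -/
theorem StatesDefinable.enrichedState_mem [Finite P] {G : AsyncTransducer D (P → P → Bool)}
    {A : AsyncAutomaton (D.prodLabel (P → P → Bool))} (h : StatesDefinable G A)
    (R : Set (Σ x : Letter × (P → P → Bool), (D.prodLabel (P → P → Bool)).LState A.S x)) :
    EventDefinable (fun t e => enrichedState G A t e ∈ R) := by
  have := A.finite
  have key : ∀ x : Σ x : Letter × (P → P → Bool), (D.prodLabel (P → P → Bool)).LState A.S x,
      EventDefinable (fun t e => x ∈ R ∧ enrichedLabel t e = x.1 ∧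
        ∀ j : (D.prodLabel (P → P → Bool)).loc x.1,
          e ∈ t.procEvents j.1 ∧ cascadeStateAt G A t e j.1 = x.2 j) := fun x =>
    (EventDefinable.const _).and ((EventDefinable.enrichedLabel_eq x.1).and
      (EventDefinable.forall_finite fun j => h.event j.1 (x.2 j)))
  refine (EventDefinable.exists_finite key).congr fun t e => ?_
  constructor
  · rintro ⟨⟨x, s⟩, hx, hl, hs⟩
    dsimp only at hl hs
    subst hl
    have : enrichedState G A t e = ⟨enrichedLabel t e, s⟩ := by
      rw [enrichedState]
      congr 1
      funext j
      exact (hs j).2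
    rwa [this]
  · exact fun hR => ⟨_, hR, rfl, fun j => ⟨j.2, rfl⟩⟩

/-- Induction on the factors: the reset conditions of the last factor are properties of the enriched
states of the preceding ones, hence definable, and so its bit is definable. -/
theorem statesDefinable_of_isU2Cascade [Finite P] {G : AsyncTransducer D (P → P → Bool)}
    (hG : IsGossip G) (A : AsyncAutomaton (D.prodLabel (P → P → Bool))) (hA : IsU2Cascade A) :
    StatesDefinable G A := by
  induction hA with
  | single p R₁ R₂ c h₁ h₂ hd =>
    have hdef : ∀ R : Set (Letter × (P → P → Bool)),
        EventDefinable (D := D) (fun t e => enrichedLabel t e ∈ R) := fun R =>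
      (EventDefinable.exists_finite fun x => (EventDefinable.const (x ∈ R)).and
        (EventDefinable.enrichedLabel_eq x)).congr fun t e =>
          ⟨fun ⟨x, hx, h⟩ => h ▸ hx, fun h => ⟨_, h, rfl⟩⟩
    have hb := isResetBit_U2 hG p R₁ R₂ c
    constructor
    · intro i s
      by_cases hi : i = p
      · subst hi
        exact (hb.eventDefinable_eq (hdef R₁) (hdef R₂) (s rfl)).congr fun t e =>
          and_congr_right fun _ => ⟨fun h => funext fun _ => h, fun h => congrFun h rfl⟩
      -- The state set of a process other than `p` is a singleton, so every state equals `s`.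
      · exact (EventDefinable.mem_procEvents i).congr fun t e =>
          ⟨fun h => ⟨h, funext fun hp => absurd hp hi⟩, fun h => h.1⟩
    · intro i s
      by_cases hi : i = p
      · subst hi
        exact (hb.traceDefinable_eq (hdef R₁) (hdef R₂) (s rfl)).congr fun t =>
          ⟨fun h => funext fun _ => h, fun h => congrFun h rfl⟩
      · exact (TraceDefinable.const True).congr fun t =>
          ⟨fun _ => funext fun hp => absurd hp hi, fun _ => trivial⟩
  | cascade A hA p R₁ R₂ c h₁ h₂ hd ih =>
    have hb := isResetBit_cascade (A := A) hG p R₁ R₂ c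
    have hstate : ∀ t C hC i
        (s : (A.localCascade (U2 A.outAlphabet p R₁ R₂ c)).S i),
        cascadeState G (A.localCascade (U2 A.outAlphabet p R₁ R₂ c)) t C hC i = s ↔
          cascadeState G A t C hC i = s.1 ∧
          (cascadeState G (A.localCascade (U2 A.outAlphabet p R₁ R₂ c)) t C hC i).2 = s.2 := by
      intro t C hC i s
      rw [← cascadeState_localCascade_fst (U2 A.outAlphabet p R₁ R₂ c)]
      exact Prod.ext_iff
    constructor
    · intro i s
      by_cases hi : i = p
      · subst hi
        refine ((ih.event i s.1).and (hb.eventDefinable_eq (ih.enrichedState_mem R₁)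
          (ih.enrichedState_mem R₂) (s.2 rfl))).congr fun t e => ?_
        constructor
        · rintro ⟨⟨he, h⟩, -, h'⟩
          exact ⟨he, (hstate _ _ _ _ _).2 ⟨h, funext fun _ => h'⟩⟩
        · rintro ⟨he, h⟩
          have h := (hstate _ _ _ _ _).1 h
          exact ⟨⟨he, h.1⟩, he, congrFun h.2 rfl⟩
      · refine (ih.event i s.1).congr fun t e => and_congr_right fun _ => ?_
        exact ⟨fun h => (hstate _ _ _ _ _).2 ⟨h, funext fun hp => absurd hp hi⟩,
          fun h => ((hstate _ _ _ _ _).1 h).1⟩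
    · intro i s
      by_cases hi : i = p
      · subst hi
        refine ((ih.trace i s.1).and (hb.traceDefinable_eq (ih.enrichedState_mem R₁)
          (ih.enrichedState_mem R₂) (s.2 rfl))).congr fun t => ?_
        refine Iff.trans (and_congr_right fun _ => ?_) (hstate _ _ _ _ _).symm
        exact ⟨fun h => funext fun _ => h, fun h => congrFun h rfl⟩
      · refine (ih.trace i s.1).congr fun t => ?_
        exact ⟨fun h => (hstate _ _ _ _ _).2 ⟨h, funext fun hp => absurd hp hi⟩,
          fun h => ((hstate _ _ _ _ _).1 h).1⟩

theorem definable_of_acceptedByRestrictedU2Cascade [Finite P]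
    {G : AsyncTransducer D (P → P → Bool)} (hG : IsGossip G) {L : Set (MTrace D)}
    (h : AcceptedByRestrictedU2Cascade G L) : LocTLDefinable L := by
  obtain ⟨A, hA, F, hF⟩ := h
  have := A.finite
  have hs := statesDefinable_of_isU2Cascade hG A hA
  obtain ⟨β, hβ⟩ : TraceDefinable (fun t => ∃ s : A.Global, s ∈ F ∧
      ∀ i, cascadeState G A t Set.univ isLowerSet_univ i = s i) :=
    TraceDefinable.exists_finite fun s =>
      (TraceDefinable.const _).and (TraceDefinable.forall_finite fun i => hs.trace i (s i))
  refine ⟨β, ?_⟩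
  rw [hF]
  ext t
  refine (mem_accepting_iff F t).trans (Iff.trans ?_ (hβ t).symm)
  exact ⟨fun h => ⟨_, h, fun _ => rfl⟩, fun ⟨s, hs, h⟩ => (funext h : _ = s) ▸ hs⟩

end AutomatonToFormula

theorem AsyncAutomaton.IsU2Cascade.nonempty_process {P Letter : Type*} {D : DistAlphabet P Letter}
    {A : AsyncAutomaton D} (h : IsU2Cascade A) : Nonempty P := by
  cases h with
  | single p => exact ⟨p⟩
  | cascade _ _ p => exact ⟨p⟩

theorem corollary5 {P Letter : Type*} [Finite P] [Finite Letter] (D : DistAlphabet P Letter) :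
    (∃ G : AsyncTransducer D (P → P → Bool), IsGossip G) ∧
    ∀ G : AsyncTransducer D (P → P → Bool), IsGossip G →
      ∀ L : Set (MTrace D), LocTLDefinable L ↔ AcceptedByRestrictedU2Cascade G L := by
  refine ⟨⟨Gossip.automaton D, Gossip.isGossip_automaton⟩, fun G hG L => ⟨fun h => ?_, fun h => ?_⟩⟩
  · exact acceptedByRestrictedU2Cascade_of_definable hG h
  · obtain ⟨A, hA, h'⟩ := h
    -- If there are no processes, there are neither trace formulas nor cascades and both sides fail.
    -- In each direction the given object supplies a process.
    have := hA.nonempty_process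
    exact definable_of_acceptedByRestrictedU2Cascade hG ⟨A, hA, h'⟩
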